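/- Fix an integer $d>13$ and reals $B>A>0$, $\kappa>0$. For $n\ge 1$ let $S_L=S_L(n)$ be the set of linear $n$-qudit Hamiltonians on $(\mathbb{C}^d)^{\otimes n}$ $$H=h_1\otimes I\otimes\cdots\otimes I+\cdots+I\otimes\cdots\otimes I\otimes h_n,\qquad h_i=\sum_{j=1}^d\mu_{i,j}|\phi_j\rangle\langle\phi_j|,$$ where $\{|\phi_1\rangle,\dots,|\phi_d\rangle\}$ is any orthonormal basis of $\mathbb{C}^d$ (common to all sites), $\mu_{i,j}\in[-B,-A]\cup[A,B]$, and there are $j\ne j'$ with $\sum_{i}\mu_{i,j}-\sum_{i}\mu_{i,j'}\ge\kappa n$ (the difference is at most $2Bn$, so it is $\Theta(n)$). For a unit vector $|\psi\rangle$ let $F_Q(|\psi\rangle,H)=4(\langle\psi|H^2|\psi\rangle-\langle\psi|H|\psi\rangle^2)$ be the quantum Fisher information. Let $|\psi\rangle\leftarrow Sym^n(\mathbb{C}^d)$ be uniformly distributed on the unit sphere of the symmetric subspace of $(\mathbb{C}^d)^{\otimes n}$. For $H\in S_L$ put $H_S=\frac1{n!}\sum_{\pi\in S_n}V(\pi)HV(\pi)^\dagger$,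 where $V(\pi)$ permutes the tensor factors, and $E(H)=\mathbb{E}_{|\psi'\rangle\leftarrow Sym^n(\mathbb{C}^d)}[F_Q(|\psi'\rangle,H_S)]$. Then: 1. There are constants $C>0$, depending only on $d$, and $K>0$, depending only on $d,A,B$, such that for all $0<\epsilon<c$ and all $n\ge1$, $$\Pr_{|\psi\rangle}\Big(\inf_{H\in S_L}\big(F_Q(|\psi\rangle,H)-E(H)\big)<-c\Big)\le\Big(\frac{B-A}{\epsilon_c}+4\Big)^{dn}\Big(\frac5{\epsilon_p}\Big)^{d(d+1)}2\exp\Big(-\frac{2\binom{n+d-1}{n}(c-\epsilon)^2}{144\pi^3\ln 2\,(2+2\sqrt2)^2(Kn)^4}\Big),$$ with $\epsilon_c=\epsilon\big/\big(8(2dnB+(dn)^2(2B+2)+4Bn(n+d)/d)\big)$ and $\epsilon_p=\epsilon\big/\big(8(1+2\sqrt2)\,d\,C\,n\,(dnB)^2\big)$; for fixed $c,\epsilon$ the right-hand side tends to $0$ as $n\to\infty$. 2. For every $c>0$, $\Pr_{|\psi\rangle}\big(\sup_{H\in S_L}(E(H)-F_Q(|\psi\rangle,H))>c\big)\to0$ as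 $n\to\infty$. 3. $E(H)=\Theta(n^2)$ uniformly on $S_L$: there are $a,b>0$, independent of $n$ and $H$, with $an^2\le E(H)\le bn^2$ for all $n\ge1$ and $H\in S_L(n)$; and for every $c>0$, $\Pr_{|\psi\rangle}\big(\sup_{H\in S_L}(an^2-F_Q(|\psi\rangle,H))>c\big)\to0$ as $n\to\infty$. (The events with $\inf<-c$ and $\sup>c$ mean that some $H\in S_L$ satisfies the strict inequality.) -/

import Mathlib

open MeasureTheory

noncomputable section

namespace SymQFI

/-- Operators on `(ℂ^d)^{⊗n}`, as matrices in the product basis `|x₁ … xₙ⟩`, `x : Fin n → Fin d`. -/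
abbrev Op (n d : ℕ) : Type := Matrix (Fin n → Fin d) (Fin n → Fin d) ℂ

/-- The `n`-qudit space `(ℂ^d)^{⊗n}` in the product basis, with its Hilbert space norm. -/
abbrev Qudits (n d : ℕ) : Type := EuclideanSpace ℂ (Fin n → Fin d)

/-- The tensor product `M₁ ⊗ ⋯ ⊗ Mₙ` of single-qudit operators. -/
def tensorOp {n d : ℕ} (M : Fin n → Matrix (Fin d) (Fin d) ℂ) : Op n d :=
  Matrix.of fun x y => ∏ k, M k (x k) (y k)

/-- `I ⊗ ⋯ ⊗ h ⊗ ⋯ ⊗ I` with `h` at site `i`. -/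
def siteOp {n d : ℕ} (i : Fin n) (h : Matrix (Fin d) (Fin d) ℂ) : Op n d :=
  tensorOp (Function.update (fun _ => 1) i h)

/-- The linear Hamiltonian `∑ᵢ I ⊗ ⋯ ⊗ hᵢ ⊗ ⋯ ⊗ I`. -/
def linearHam {n d : ℕ} (h : Fin n → Matrix (Fin d) (Fin d) ℂ) : Op n d :=
  ∑ i, siteOp i (h i)

/-- The single-qudit Hermitian operator `∑ⱼ μⱼ |φⱼ⟩⟨φⱼ|`. -/
def levelHam {d : ℕ} (φ : OrthonormalBasis (Fin d) ℂ (EuclideanSpace ℂ (Fin d)))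
    (μ : Fin d → ℝ) : Matrix (Fin d) (Fin d) ℂ :=
  ∑ j, (μ j : ℂ) • Matrix.of fun a b => φ j a * star (φ j b)

/-- The class `S_L`: linear Hamiltonians whose `hᵢ = ∑ⱼ μᵢⱼ |φⱼ⟩⟨φⱼ|` are diagonal in a common
orthonormal basis, with all `μᵢⱼ ∈ [-B,-A] ∪ [A,B]`, and with two levels whose column sums differ
by at least `κ n` (they always differ by at most `2 B n`). -/
def linearClass (n d : ℕ) (A B κ : ℝ) : Set (Op n d) :=
  {H | ∃ (φ : OrthonormalBasis (Fin d) ℂ (EuclideanSpace ℂ (Fin d))) (μ : Fin n → Fin d → ℝ),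
    (∀ i j, μ i j ∈ Set.Icc (-B) (-A) ∪ Set.Icc A B) ∧
    (∃ j j', j ≠ j' ∧ κ * n ≤ ∑ i, μ i j - ∑ i, μ i j') ∧
    H = linearHam fun i => levelHam φ (μ i)}

/-- The permutation operator `V(π) |ψ₁⟩⊗⋯⊗|ψₙ⟩ = |ψ_{π⁻¹(1)}⟩⊗⋯⊗|ψ_{π⁻¹(n)}⟩`;
in coordinates `(V(π) ψ)(x) = ψ(x ∘ π)`. -/
def permOp {n : ℕ} (d : ℕ) (π : Equiv.Perm (Fin n)) : Op n d :=
  Matrix.of fun x y => if y = x ∘ π then 1 else 0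

/-- The average `(1/n!) ∑_π V(π) H V(π)†`. -/
def twirl {n d : ℕ} (H : Op n d) : Op n d :=
  ((n.factorial : ℂ)⁻¹) • ∑ π : Equiv.Perm (Fin n), permOp d π * H * (permOp d π).conjTranspose

/-- The symmetric subspace `Sym^n(ℂ^d)`. -/
def symSpace (n d : ℕ) : Submodule ℂ (Qudits n d) :=
  ⨅ π : Equiv.Perm (Fin n),
    LinearMap.eqLocus (Matrix.toEuclideanLin (permOp d π)) LinearMap.id

/-- The symmetric pure states (unit vectors of `Sym^n(ℂ^d)`). -/
abbrev SymState (n d : ℕ) : Type := Metric.sphere (0 : symSpace n d) 1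

/-- The uniform probability measure on symmetric pure states: the normalized surface measure on
the unit sphere of `Sym^n(ℂ^d)`. -/
def uniformSym (n d : ℕ) : Measure (SymState n d) :=
  ((Measure.addHaar : Measure (symSpace n d)).toSphere Set.univ)⁻¹ •
    (Measure.addHaar : Measure (symSpace n d)).toSphere

/-- The quantum Fisher information `4 (⟨ψ|H²|ψ⟩ - ⟨ψ|H|ψ⟩²)` of a pure state. -/
def qfi {n d : ℕ} (ψ : Qudits n d) (H : Op n d) : ℝ :=
  4 * ((inner ℂ ψ (Matrix.toEuclideanLin (H * H) ψ)).re -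
    (inner ℂ ψ (Matrix.toEuclideanLin H ψ)).re ^ 2)

/-- `E[F_Q(ψ, H_S)]` over uniformly random symmetric states, where `H_S` is the average of `H`. -/
def meanQFI {n d : ℕ} (H : Op n d) : ℝ :=
  ∫ ψ : SymState n d, qfi (ψ : symSpace n d) (twirl H) ∂uniformSym n d

/-- The mesh of the coefficients. -/
def epsC (d : ℕ) (B ε : ℝ) (n : ℕ) : ℝ :=
  ε / (8 * (2 * (d * n) * B + (d * n) ^ 2 * (2 * B + 2) + 4 * B * n * (n + d) / d))

/-- The mesh of the basis vectors. -/
def epsP (d : ℕ) (C B ε : ℝ) (n : ℕ) : ℝ :=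
  ε / (8 * (1 + 2 * √2) * d * C * n * (d * n * B) ^ 2)

/-- The explicit bound on the probability; `C` is a constant and `K * n` a quantity of order `n`. -/
def tailBound (d : ℕ) (C K A B c ε : ℝ) (n : ℕ) : ℝ :=
  ((B - A) / epsC d B ε n + 4) ^ (d * n) * (5 / epsP d C B ε n) ^ (d * (d + 1)) *
    (2 * Real.exp (-(2 * ((n + d - 1).choose n : ℝ) * (c - ε) ^ 2 /
      (144 * Real.pi ^ 3 * Real.log 2 * (2 + 2 * √2) ^ 2 * (K * n) ^ 4))))

end SymQFI

end

noncomputable section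

namespace SymQFI

/-! Averaging over permutations cannot increase the Fisher information of a symmetric state $\psi$.
Every $V(\pi)$ fixes $\psi$, so $\langle H_S\rangle=\langle H\rangle$, and the triangle inequality
gives $\|H_S\psi\|\le\|H\psi\|$ (`qfi_twirl_le`). It therefore suffices to bound $F_Q(\psi,H_S)$
from below. By `twirl_linearHam`, $H_S$ is collective: the same one-site Hamiltonian acts at every
site, and its levels $v_j$ are the site averages of the $\mu_{i,j}$.

Uniformity over the infinite class needs no net. A collective Hamiltonian is a combination of the
$d^2$ fixed operators `unitHam`, with coefficients at most $dB$, and its square is a combination of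
their $d^4$ products. Once the expectations of these finitely many operators are close to their
normalized traces on the symmetric subspace, $F_Q(\psi,H_S)$ is at least $4\,$`energyVar` minus a
small error for all $H$ at once (`le_qfi_collHam`). A union bound then gives
`uniformSym_class_tail`. Each single expectation concentrates by a Chernoff argument in Gaussian
coordinates (`uniformSphere_diag_tail`), at a rate proportional to the dimension
$D=\binom{n+d-1}{n}$.

For the mean, the second moments of the occupation probabilities give
$E(H)=\frac{4D}{D+1}\,$`energyVar` exactly (`meanQFI_eq`), which lies between 2 and 4 times the
variance. Moments of occupation numbers and Cauchy–Schwarz bound that variance below by a multiple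
of $n^2$ (`le_variance_occ`).

The stated bound, with its covering factors, is weaker than the one obtained: `le_tailBound`
compares them with $C=1$ and $K=$ `tailConst`. It tends to $0$ because $D\ge n^{d-1}/(d-1)!$
outgrows the logarithm of the prefactor times $n^4$. -/

theorem norm_sum_smul_sq {E ι : Type*} [NormedAddCommGroup E] [InnerProductSpace ℂ E] [Fintype ι]
    (b : OrthonormalBasis ι ℂ E) (g : ι → ℂ) :
    ‖∑ i, g i • b i‖ ^ 2 = ∑ i, ‖g i‖ ^ 2 := by
  rw [← b.sum_sq_norm_inner_right]
  refine Finset.sum_congr rfl fun i _ ↦ ?_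
  rw [b.orthonormal.inner_right_fintype]

/-! ### Uniform measure on a sphere through polar and Gaussian coordinates -/

section Sphere

variable {E : Type*} [NormedAddCommGroup E] [InnerProductSpace ℂ E] [FiniteDimensional ℂ E]
  [MeasurableSpace E] [BorelSpace E]

/-- The normalized surface measure on the unit sphere. -/
def uniformSphere (μ : Measure E) : Measure (Metric.sphere (0 : E) 1) :=
  (μ.toSphere Set.univ)⁻¹ • μ.toSphere

variable (μ : Measure E) [μ.IsAddHaarMeasure]

theorem isProbabilityMeasure_uniformSphere [Nontrivial E] :
    IsProbabilityMeasure (uniformSphere μ) := by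
  refine ⟨?_⟩
  rw [uniformSphere, Measure.smul_apply, smul_eq_mul]
  exact ENNReal.inv_mul_cancel (by simp [-Measure.toSphere_apply_univ])
    (measure_ne_top _ _)

/-- Polar coordinates: the direction is uniform and independent of the norm. -/
theorem integral_direction_mul_norm [Nontrivial E] (F : E → ℝ) (w : ℝ → ℝ) :
    ∫ x, F (‖x‖⁻¹ • x) * w ‖x‖ ∂μ =
      (∫ ψ : Metric.sphere (0 : E) 1, F ψ ∂uniformSphere μ) * ∫ x, w ‖x‖ ∂μ := by
  have key : ∀ G : E → ℝ, ∫ x, G (‖x‖⁻¹ • x) * w ‖x‖ ∂μ =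
      (∫ ψ : Metric.sphere (0 : E) 1, G ψ ∂μ.toSphere) *
        ∫ r : Set.Ioi (0 : ℝ), w r ∂.volumeIoiPow (Module.finrank ℝ E - 1) := by
    intro G
    calc ∫ x, G (‖x‖⁻¹ • x) * w ‖x‖ ∂μ
        = ∫ x : ({(0)}ᶜ : Set E), G (‖x.1‖⁻¹ • x.1) * w ‖x.1‖ ∂(μ.comap (↑)) := by
          rw [integral_subtype_comap (measurableSet_singleton _).compl
            fun x ↦ G (‖x‖⁻¹ • x) * w ‖x‖, restrict_compl_singleton]
      _ = ∫ x, G x.1 * w x.2 ∂μ.toSphere.prod (.volumeIoiPow (Module.finrank ℝ E - 1)) := by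
          simpa using μ.measurePreserving_homeomorphUnitSphereProd.integral_comp
            (Homeomorph.measurableEmbedding _)
            (fun x : Metric.sphere (0 : E) 1 × Set.Ioi (0 : ℝ) ↦ G x.1 * w x.2)
      _ = _ := integral_prod_mul (fun ψ : Metric.sphere (0 : E) 1 ↦ G ψ)
            fun r : Set.Ioi (0 : ℝ) ↦ w r
  have h1 := key fun _ ↦ 1
  have h0 : μ.toSphere.real Set.univ ≠ 0 := by
    rw [Measure.real, ENNReal.toReal_ne_zero]
    exact ⟨by simp [-Measure.toSphere_apply_univ], measure_ne_top _ _⟩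
  simp only [one_mul, integral_const, smul_eq_mul, mul_one] at h1
  rw [key F, h1, uniformSphere, integral_smul_measure, ENNReal.toReal_inv, smul_eq_mul]
  change _ = (μ.toSphere.real Set.univ)⁻¹ * _ * _
  field_simp

variable {ι : Type*} [Fintype ι]

/-- Integrals against a Haar measure in the coordinates of an orthonormal basis. -/
theorem exists_integral_eq_mul_integral_pi (b : OrthonormalBasis ι ℂ E) :
    ∃ c : ℝ, 0 < c ∧ ∀ f : E → ℝ, ∫ x, f x ∂μ = c * ∫ g : ι → ℂ, f (∑ i, g i • b i) := by
  let L : E ≃L[ℝ] (ι → ℂ) :=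
    (b.toBasis.equivFun.restrictScalars ℝ).toContinuousLinearEquiv
  have hL : ∀ g : ι → ℂ, L.symm g = ∑ i, g i • b i := fun g ↦
    (b.toBasis.equivFun_symm_apply g).trans (by simp)
  have hm : MeasurableEmbedding L.symm := L.symm.toHomeomorph.measurableEmbedding
  have : (Measure.map L.symm (volume : Measure (ι → ℂ))).IsAddHaarMeasure :=
    L.symm.isAddHaarMeasure_map _
  have hu := Measure.isAddLeftInvariant_eq_smul μ (Measure.map L.symm (volume : Measure (ι → ℂ)))
  set c := μ.addHaarScalarFactor (Measure.map L.symm (volume : Measure (ι → ℂ)))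
  refine ⟨c, ?_, fun f ↦ ?_⟩
  · exact Measure.addHaarScalarFactor_pos_of_isAddHaarMeasure _ _
  · conv_lhs => rw [hu]
    rw [integral_smul_nnreal_measure, hm.integral_map, NNReal.smul_def, smul_eq_mul]
    simp_rw [hL]

/-- The uniform measure on the sphere as the direction of a vector with independent complex
Gaussian coordinates. -/
theorem integral_uniformSphere_mul [Nontrivial E] (b : OrthonormalBasis ι ℂ E) (F : E → ℝ)
    (w : ℝ → ℝ) :
    (∫ ψ : Metric.sphere (0 : E) 1, F ψ ∂uniformSphere μ) *
        ∫ g : ι → ℂ, w (∑ i, ‖g i‖ ^ 2) =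
      ∫ g : ι → ℂ, F (‖∑ i, g i • b i‖⁻¹ • ∑ i, g i • b i) * w (∑ i, ‖g i‖ ^ 2) := by
  obtain ⟨c, hc, h⟩ := exists_integral_eq_mul_integral_pi μ b
  -- The weight is taken as a function of $\|x\|^2$, since this is what becomes $\sum_i|g_i|^2$ in
  -- coordinates.
  have h1 := integral_direction_mul_norm μ F fun r ↦ w (r ^ 2)
  rw [h, h] at h1
  simp only [norm_sum_smul_sq] at h1
  have : c ≠ 0 := hc.ne'
  apply mul_left_cancel₀ this
  rw [h1]; ring

end Sphere

/-! ### Gaussian integrals over the complex plane -/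

section Gaussian

theorem integral_exp_neg_mul_norm_sq {r : ℝ} (hr : 0 < r) :
    ∫ z : ℂ, Real.exp (-r * ‖z‖ ^ 2) = Real.pi / r := by
  have := Complex.integral_exp_neg_mul_rpow (p := 2) one_le_two hr
  norm_num [Real.rpow_neg_one] at this
  rw [div_eq_mul_inv, ← this]
  simp

theorem integral_norm_sq_mul_exp :
    ∫ z : ℂ, ‖z‖ ^ 2 * Real.exp (-‖z‖ ^ 2) = Real.pi := by
  have := Complex.integral_rpow_mul_exp_neg_rpow (p := 2) (q := 2) one_le_two (by norm_num)
  have h2 : Real.Gamma 2 = 1 := by simp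
  norm_num [h2] at this
  exact this

theorem integral_norm_pow_four_mul_exp :
    ∫ z : ℂ, ‖z‖ ^ 4 * Real.exp (-‖z‖ ^ 2) = 2 * Real.pi := by
  have := Complex.integral_rpow_mul_exp_neg_rpow (p := 2) (q := 4) one_le_two (by norm_num)
  have h2 : Real.Gamma 3 = 2 := by simp [Real.Gamma_ofNat_eq_factorial, Nat.factorial]
  norm_num [h2] at this
  rw [mul_comm, ← this]

/-- The Bochner integral of a non-integrable function is $0$ by convention, so an explicit positive
value already certifies integrability. -/
theorem integrable_of_integral_pos {α : Type*} [MeasurableSpace α] {μ : Measure α} {f : α → ℝ}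
    (h : 0 < ∫ x, f x ∂μ) : Integrable f μ :=
  not_imp_comm.1 integral_undef h.ne'

end Gaussian

/-! ### Moments of independent complex Gaussian coordinates -/

section Gaussian

variable {ι : Type*} [Fintype ι]

theorem integral_exp_neg_sum_mul_norm_sq (a : ι → ℝ) (ha : ∀ i, 0 < a i) :
    ∫ g : ι → ℂ, Real.exp (-∑ i, a i * ‖g i‖ ^ 2) = ∏ i, Real.pi / a i := by
  have h := integral_fintype_prod_volume_eq_prod (𝕜 := ℝ)
    (fun (i : ι) (z : ℂ) ↦ Real.exp (-a i * ‖z‖ ^ 2))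
  simp only [integral_exp_neg_mul_norm_sq (ha _)] at h
  rw [← h]
  congr 1; ext g
  rw [← Real.exp_sum, ← Finset.sum_neg_distrib]
  simp

theorem integral_exp_neg_sum_norm_sq :
    ∫ g : ι → ℂ, Real.exp (-∑ i, ‖g i‖ ^ 2) = Real.pi ^ Fintype.card ι := by
  have := integral_exp_neg_sum_mul_norm_sq (ι := ι) (fun _ ↦ 1) (fun _ ↦ one_pos)
  simpa using this

variable [DecidableEq ι]

theorem integral_norm_sq_mul_norm_sq_mul_exp (k l : ι) :
    ∫ g : ι → ℂ, ‖g k‖ ^ 2 * ‖g l‖ ^ 2 * Real.exp (-∑ i, ‖g i‖ ^ 2) =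
      (if k = l then 2 else 1) * Real.pi ^ Fintype.card ι := by
  have h := integral_fintype_prod_volume_eq_prod (𝕜 := ℝ)
    (fun (i : ι) (z : ℂ) ↦ (if k = i then ‖z‖ ^ 2 else 1) * (if l = i then ‖z‖ ^ 2 else 1) *
      Real.exp (-‖z‖ ^ 2))
  have hl : ∀ g : ι → ℂ, ∏ i, (if k = i then ‖g i‖ ^ 2 else 1) * (if l = i then ‖g i‖ ^ 2 else 1) *
      Real.exp (-‖g i‖ ^ 2) = ‖g k‖ ^ 2 * ‖g l‖ ^ 2 * Real.exp (-∑ i, ‖g i‖ ^ 2) := by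
    intro g
    rw [Finset.prod_mul_distrib, Finset.prod_mul_distrib, ← Real.exp_sum, Finset.sum_neg_distrib]
    simp only [Finset.prod_ite_eq, Finset.mem_univ, if_true]
  simp only [hl] at h
  rw [h]
  have hr : ∀ i, ∫ z : ℂ, (if k = i then ‖z‖ ^ 2 else 1) * (if l = i then ‖z‖ ^ 2 else 1) *
      Real.exp (-‖z‖ ^ 2) = (if k = i then (if k = l then 2 else 1) else 1) * Real.pi := by
    intro i
    by_cases hk : k = i <;> by_cases hl : l = i
    · simp only [hk, hl, if_true, ← integral_norm_pow_four_mul_exp]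
      congr 1; ext z; ring
    · have : i ≠ l := fun h ↦ hl h.symm
      simp [hk, hl, this, integral_norm_sq_mul_exp]
    · simp [hk, hl, integral_norm_sq_mul_exp]
    · have := integral_exp_neg_mul_norm_sq one_pos
      simp only [hk, hl, if_false, one_mul]
      simpa using this
  simp only [hr, Finset.prod_mul_distrib, Finset.prod_ite_eq, Finset.mem_univ, if_true,
    Finset.prod_const, Finset.card_univ]

theorem integral_sq_mul_exp_neg :
    ∫ g : ι → ℂ, (∑ i, ‖g i‖ ^ 2) ^ 2 * Real.exp (-∑ i, ‖g i‖ ^ 2) =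
      Fintype.card ι * (Fintype.card ι + 1) * Real.pi ^ Fintype.card ι := by
  have h : ∀ g : ι → ℂ, (∑ i, ‖g i‖ ^ 2) ^ 2 * Real.exp (-∑ i, ‖g i‖ ^ 2) =
      ∑ k, ∑ l, ‖g k‖ ^ 2 * ‖g l‖ ^ 2 * Real.exp (-∑ i, ‖g i‖ ^ 2) := by
    intro g
    rw [sq, Finset.sum_mul_sum, Finset.sum_mul]
    simp_rw [Finset.sum_mul]
  have hi : ∀ k l : ι, Integrable
      fun g : ι → ℂ ↦ ‖g k‖ ^ 2 * ‖g l‖ ^ 2 * Real.exp (-∑ i, ‖g i‖ ^ 2) := by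
    intro k l
    apply integrable_of_integral_pos
    rw [integral_norm_sq_mul_norm_sq_mul_exp]
    split_ifs <;> positivity
  simp_rw [h]
  rw [integral_finsetSum _ fun k _ ↦ integrable_finsetSum _ fun l _ ↦ hi k l]
  simp_rw [integral_finsetSum _ fun l _ ↦ hi _ l, integral_norm_sq_mul_norm_sq_mul_exp,
    ← Finset.sum_mul]
  congr 1
  have : ∀ k l : ι, (if k = l then (2 : ℝ) else 1) = 1 + if k = l then 1 else 0 := by
    intro k l; split_ifs <;> norm_num
  simp only [this, Finset.sum_add_distrib]
  simp
  ring

end Gaussian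

/-! ### Second moments and exponential tails on the sphere -/

section Sphere

variable {E : Type*} [NormedAddCommGroup E] [InnerProductSpace ℂ E] [FiniteDimensional ℂ E]
  [MeasurableSpace E] [BorelSpace E] (μ : Measure E) [μ.IsAddHaarMeasure] [Nontrivial E]
  {ι : Type*} [Fintype ι]

/-- With radial weight $r^2e^{-r}$, where $r=\|x\|^2$, the factor $r^2$ cancels the normalization of
the two probabilities. What remains is a quotient of Gaussian moments. -/
theorem integral_prob_mul_prob [DecidableEq ι] (b : OrthonormalBasis ι ℂ E) (k l : ι) :
    ∫ ψ : Metric.sphere (0 : E) 1, ‖inner ℂ (b k) (ψ : E)‖ ^ 2 * ‖inner ℂ (b l) (ψ : E)‖ ^ 2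
        ∂uniformSphere μ =
      (if k = l then 2 else 1) / (Fintype.card ι * (Fintype.card ι + 1)) := by
  have h := integral_uniformSphere_mul μ b
    (fun x ↦ ‖inner ℂ (b k) x‖ ^ 2 * ‖inner ℂ (b l) x‖ ^ 2) (fun r ↦ r ^ 2 * Real.exp (-r))
  rw [integral_sq_mul_exp_neg] at h
  have hr : ∀ g : ι → ℂ,
      ‖inner ℂ (b k) (‖∑ i, g i • b i‖⁻¹ • ∑ i, g i • b i)‖ ^ 2 *
        ‖inner ℂ (b l) (‖∑ i, g i • b i‖⁻¹ • ∑ i, g i • b i)‖ ^ 2 *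
        ((∑ i, ‖g i‖ ^ 2) ^ 2 * Real.exp (-∑ i, ‖g i‖ ^ 2)) =
      ‖g k‖ ^ 2 * ‖g l‖ ^ 2 * Real.exp (-∑ i, ‖g i‖ ^ 2) := by
    intro g
    rw [RCLike.real_smul_eq_coe_smul (K := ℂ), inner_smul_right, inner_smul_right, ← norm_sum_smul_sq b,
      b.orthonormal.inner_right_fintype, b.orthonormal.inner_right_fintype]
    -- At the origin the inverse norm is $0$ by convention, and both sides vanish because every
    -- coordinate does.
    by_cases h0 : ‖∑ i, g i • b i‖ = 0
    · have h2 := norm_sum_smul_sq b g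
      rw [h0] at h2
      have h3 : ∀ i ∈ Finset.univ, ‖g i‖ ^ 2 = 0 :=
        (Finset.sum_eq_zero_iff_of_nonneg fun i _ ↦ by positivity).1 (by simpa using h2.symm)
      simp [h0, h3 k]
    · simp only [norm_mul, RCLike.norm_ofReal, abs_inv, abs_norm]
      field_simp
  simp_rw [hr, integral_norm_sq_mul_norm_sq_mul_exp] at h
  have : Nonempty ι := ⟨k⟩
  have hc : (0 : ℝ) < Fintype.card ι := by exact_mod_cast Fintype.card_pos
  have hp : (0 : ℝ) < Real.pi ^ Fintype.card ι := by positivity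
  rw [eq_div_iff (by positivity)]
  apply mul_right_cancel₀ hp.ne'
  rw [← h]; ring

/-- Concentration of a diagonal quadratic form on the sphere, upper tail. -/
theorem uniformSphere_diag_tail (b : OrthonormalBasis ι ℂ E) (v : ι → ℝ) {R t : ℝ}
    (hR : 0 < R) (hv : ∀ i, |v i| ≤ R) (ht : 0 < t) :
    (uniformSphere μ).real {ψ | t < ∑ i, v i * ‖inner ℂ (b i) (ψ : E)‖ ^ 2 -
        (∑ i, v i) / Fintype.card ι} ≤
      Real.exp (-(Fintype.card ι * t ^ 2 / (128 * R ^ 2))) := by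
  have hne : Nonempty ι := by
    by_contra h
    rw [not_nonempty_iff] at h
    have := b.toBasis.index_nonempty
    exact h.elim this.some
  have hc : (0 : ℝ) < Fintype.card ι := by exact_mod_cast Fintype.card_pos
  set m := (∑ i, v i) / Fintype.card ι with hm
  have hmR : |m| ≤ R := by
    rw [hm, abs_div, Nat.abs_cast, div_le_iff₀ hc]
    refine (Finset.abs_sum_le_sum_abs _ _).trans ((Finset.sum_le_sum fun i _ ↦ hv i).trans ?_)
    simp [mul_comm]
  have hnorm : ∀ ψ : Metric.sphere (0 : E) 1, ∑ i, ‖inner ℂ (b i) (ψ : E)‖ ^ 2 = 1 := by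
    intro ψ
    rw [b.sum_sq_norm_inner_right]
    simp
  -- The form and its mean both lie in $[-R,R]$, so a deviation above $2R$ is impossible. In the
  -- remaining case $t\le 2R$ keeps the Chernoff parameter admissible.
  by_cases htR : 2 * R < t
  · have : {ψ : Metric.sphere (0 : E) 1 | t < ∑ i, v i * ‖inner ℂ (b i) (ψ : E)‖ ^ 2 - m} = ∅ := by
      ext ψ
      simp only [Set.mem_ofPred_eq, Set.mem_empty_iff_false, iff_false, not_lt]
      have : ∑ i, v i * ‖inner ℂ (b i) (ψ : E)‖ ^ 2 ≤ ∑ i, R * ‖inner ℂ (b i) (ψ : E)‖ ^ 2 :=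
        Finset.sum_le_sum fun i _ ↦ by gcongr; exact (abs_le.1 (hv i)).2
      rw [← Finset.mul_sum, hnorm ψ] at this
      linarith [(abs_le.1 hmR).1]
    rw [this]
    simpa using (Real.exp_pos _).le
  push Not at htR
  -- On the sphere the event reads $\sum_i a_i|\langle b_i,\psi\rangle|^2>0$. This condition is
  -- invariant under scaling, so it can be tested on an unnormalized Gaussian vector.
  set a : ι → ℝ := fun i ↦ v i - m - t with ha
  -- This value minimizes the final exponent $N(-st+32s^2R^2)$, where $N$ is the dimension, and
  -- gives $-Nt^2/(128R^2)$.
  set s := t / (64 * R ^ 2) with hs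
  have hs0 : 0 < s := by positivity
  have haR : ∀ i, |a i| ≤ 4 * R := by
    intro i
    have h1 := abs_le.1 (hv i)
    have h2 := abs_le.1 hmR
    exact abs_le.2 ⟨by simp only [ha]; linarith, by simp only [ha]; linarith⟩
  have hsa : ∀ i, s * a i ≤ 1 / 2 := by
    intro i
    calc s * a i ≤ s * (4 * R) := by gcongr; exact (abs_le.1 (haR i)).2
      _ = t / (16 * R) := by rw [hs]; field_simp; norm_num
      _ ≤ 1 / 2 := by rw [div_le_div_iff₀ (by positivity) (by norm_num)]; linarith
  have hsa1 : ∀ i, 0 < 1 - s * a i := fun i ↦ by linarith [hsa i]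
  set A := {ψ : Metric.sphere (0 : E) 1 | t < ∑ i, v i * ‖inner ℂ (b i) (ψ : E)‖ ^ 2 - m} with hA
  have hAm : MeasurableSet A := by
    refine (isOpen_lt continuous_const ?_).measurableSet
    fun_prop
  have h := integral_uniformSphere_mul μ b
    ({x : E | 0 < ∑ i, a i * ‖inner ℂ (b i) x‖ ^ 2}.indicator fun _ ↦ 1) (fun r ↦ Real.exp (-r))
  have hl : ∫ ψ : Metric.sphere (0 : E) 1,
      {x : E | 0 < ∑ i, a i * ‖inner ℂ (b i) x‖ ^ 2}.indicator (fun _ ↦ (1 : ℝ)) (ψ : E)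
        ∂uniformSphere μ = (uniformSphere μ).real A := by
    rw [← integral_indicator_one hAm]
    congr 1; ext ψ
    have : ∑ i, a i * ‖inner ℂ (b i) (ψ : E)‖ ^ 2 =
        ∑ i, v i * ‖inner ℂ (b i) (ψ : E)‖ ^ 2 - m - t := by
      simp only [ha, sub_mul, Finset.sum_sub_distrib, ← Finset.mul_sum, hnorm ψ, mul_one]
    simp only [Set.indicator_apply, Set.mem_ofPred_eq, this, hA, Pi.one_apply]
    congr 1
    rw [sub_pos]
  rw [hl, integral_exp_neg_sum_norm_sq] at h
  have hint := integral_exp_neg_sum_mul_norm_sq (fun i ↦ 1 - s * a i) hsa1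
  have hI : Integrable fun g : ι → ℂ ↦ Real.exp (-∑ i, (1 - s * a i) * ‖g i‖ ^ 2) := by
    apply integrable_of_integral_pos
    rw [hint]
    exact Finset.prod_pos fun i _ ↦ div_pos Real.pi_pos (hsa1 i)
  have hle : (uniformSphere μ).real A * Real.pi ^ Fintype.card ι ≤
      ∏ i, Real.pi / (1 - s * a i) := by
    rw [h, ← hint]
    refine integral_mono_of_nonneg (Filter.Eventually.of_forall fun g ↦ ?_) hI
      (Filter.Eventually.of_forall fun g ↦ ?_)
    · exact mul_nonneg (Set.indicator_nonneg (fun _ _ ↦ zero_le_one) _) (Real.exp_pos _).le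
    · have hsplit : Real.exp (-∑ i, (1 - s * a i) * ‖g i‖ ^ 2) =
          Real.exp (s * ∑ i, a i * ‖g i‖ ^ 2) * Real.exp (-∑ i, ‖g i‖ ^ 2) := by
        rw [← Real.exp_add]
        congr 1
        rw [Finset.mul_sum, ← Finset.sum_neg_distrib, ← Finset.sum_neg_distrib,
          ← Finset.sum_add_distrib]
        exact Finset.sum_congr rfl fun i _ ↦ by ring
      simp only [hsplit]
      gcongr
      -- Markov's inequality in exponential form: the indicator is at most $\exp(s\sum_i
      -- a_i|g_i|^2)$, and the product with the Gaussian density is again Gaussian.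
      refine Set.indicator_apply_le' (fun hx ↦ ?_) (fun _ ↦ (Real.exp_pos _).le)
      refine Real.one_le_exp (mul_nonneg hs0.le ?_)
      have hx' : 0 < ∑ i, a i * ‖inner ℂ (b i) (‖∑ i, g i • b i‖⁻¹ • ∑ i, g i • b i)‖ ^ 2 := hx
      have hexp : ∀ i, a i * ‖inner ℂ (b i) (‖∑ i, g i • b i‖⁻¹ • ∑ i, g i • b i)‖ ^ 2 =
          (‖∑ i, g i • b i‖⁻¹) ^ 2 * (a i * ‖g i‖ ^ 2) := by
        intro i
        rw [RCLike.real_smul_eq_coe_smul (K := ℂ), inner_smul_right, b.orthonormal.inner_right_fintype]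
        simp only [norm_mul, RCLike.norm_ofReal, abs_inv, abs_norm]
        ring
      simp only [hexp, ← Finset.mul_sum] at hx'
      exact (pos_of_mul_pos_right hx' (by positivity)).le
  have hfac : ∀ i, Real.pi / (1 - s * a i) ≤
      Real.pi * Real.exp (s * a i + 2 * (s * a i) ^ 2) := by
    intro i
    rw [div_eq_mul_inv]
    gcongr
    set x := s * a i
    have hx : x ≤ 1 / 2 := hsa i
    -- Multiplying out, $(1-x)(1+x+2x^2)=1+x^2(1-2x)\ge1$ for $x\le\frac12$.
    have : (1 - x)⁻¹ ≤ x + 2 * x ^ 2 + 1 := by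
      rw [inv_le_iff_one_le_mul₀ (hsa1 i)]
      nlinarith [sq_nonneg x]
    exact this.trans (Real.add_one_le_exp _)
  have hsum : ∑ i, (s * a i + 2 * (s * a i) ^ 2) ≤
      -(Fintype.card ι * t ^ 2 / (128 * R ^ 2)) := by
    have h1 : ∑ i, a i = -(Fintype.card ι * t) := by
      simp only [ha, Finset.sum_sub_distrib, Finset.sum_const, Finset.card_univ, nsmul_eq_mul]
      rw [hm]; field_simp; ring
    have h2 : ∀ i, a i ^ 2 ≤ 16 * R ^ 2 := by
      intro i
      rw [← sq_abs]
      calc |a i| ^ 2 ≤ (4 * R) ^ 2 := by gcongr; exact haR i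
        _ = _ := by ring
    calc ∑ i, (s * a i + 2 * (s * a i) ^ 2)
        ≤ ∑ i, (s * a i + 2 * (s ^ 2 * (16 * R ^ 2))) := by
          gcongr with i
          rw [mul_pow]
          gcongr
          exact h2 i
      _ = s * (-(Fintype.card ι * t)) + Fintype.card ι * (2 * (s ^ 2 * (16 * R ^ 2))) := by
          rw [Finset.sum_add_distrib, ← Finset.mul_sum, h1]
          simp
      _ = _ := by rw [hs]; field_simp; ring
  have hp : (0 : ℝ) < Real.pi ^ Fintype.card ι := by positivity
  refine le_of_mul_le_mul_right (hle.trans ?_) hp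
  calc ∏ i, Real.pi / (1 - s * a i)
      ≤ ∏ i, Real.pi * Real.exp (s * a i + 2 * (s * a i) ^ 2) :=
        Finset.prod_le_prod (fun i _ ↦ (div_pos Real.pi_pos (hsa1 i)).le) fun i _ ↦ hfac i
    _ = Real.exp (∑ i, (s * a i + 2 * (s * a i) ^ 2)) * Real.pi ^ Fintype.card ι := by
        rw [Finset.prod_mul_distrib, ← Real.exp_sum]
        simp [mul_comm]
    _ ≤ _ := by gcongr

end Sphere

/-! ### Concentration of operator expectations -/

section Sphere

variable {E : Type*} [NormedAddCommGroup E] [InnerProductSpace ℂ E] [FiniteDimensional ℂ E]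
  [MeasurableSpace E] [BorelSpace E] (μ : Measure E) [μ.IsAddHaarMeasure] [Nontrivial E]

/-- Concentration of the expectation of a symmetric operator, upper tail. -/
theorem uniformSphere_symmetric_tail (T : E →ₗ[ℂ] E) (hT : T.IsSymmetric) {R t : ℝ} (hR : 0 < R)
    (hb : ∀ x, ‖inner ℂ x (T x)‖ ≤ R * ‖x‖ ^ 2) (ht : 0 < t) :
    (uniformSphere μ).real {ψ | t < (inner ℂ (ψ : E) (T ψ)).re -
        (LinearMap.trace ℂ E T).re / Module.finrank ℂ E} ≤
      Real.exp (-(Module.finrank ℂ E * t ^ 2 / (128 * R ^ 2))) := by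
  set b := hT.eigenvectorBasis rfl with hbdef
  set v := hT.eigenvalues rfl with hv
  have hTb : ∀ i, T (b i) = (v i : ℂ) • b i := fun i ↦ hT.apply_eigenvectorBasis rfl i
  have hvR : ∀ i, |v i| ≤ R := by
    intro i
    have := hb (b i)
    simpa [hTb, inner_smul_right] using this
  have htr : (LinearMap.trace ℂ E T).re = ∑ i, v i := by
    rw [T.trace_eq_sum_inner b]
    simp only [hTb, inner_smul_right, Complex.re_sum]
    simp
  have hin : ∀ x : E, (inner ℂ x (T x)).re = ∑ i, v i * ‖inner ℂ (b i) x‖ ^ 2 := by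
    intro x
    rw [← b.sum_inner_mul_inner x (T x), Complex.re_sum]
    refine Finset.sum_congr rfl fun i _ ↦ ?_
    rw [← hT, hTb, inner_smul_left, Complex.conj_ofReal, mul_left_comm,
      ← inner_conj_symm x, Complex.conj_mul', ← Complex.ofReal_pow, ← Complex.ofReal_mul,
      Complex.ofReal_re]
  have h := uniformSphere_diag_tail μ b v hR hvR ht
  simp only [Fintype.card_fin] at h
  simp only [hin, htr]
  exact h

/-- Concentration of the expectation of a symmetric operator, both tails. -/
theorem uniformSphere_symmetric_abs_tail (T : E →ₗ[ℂ] E) (hT : T.IsSymmetric) {R t : ℝ}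
    (hR : 0 < R) (hb : ∀ x, ‖inner ℂ x (T x)‖ ≤ R * ‖x‖ ^ 2) (ht : 0 < t) :
    (uniformSphere μ).real {ψ | t < |(inner ℂ (ψ : E) (T ψ)).re -
        (LinearMap.trace ℂ E T).re / Module.finrank ℂ E|} ≤
      2 * Real.exp (-(Module.finrank ℂ E * t ^ 2 / (128 * R ^ 2))) := by
  have := isProbabilityMeasure_uniformSphere μ
  have h1 := uniformSphere_symmetric_tail μ T hT hR hb ht
  have h2 := uniformSphere_symmetric_tail μ (-T) (fun x y ↦ by simp [hT x y]) hR (by simpa using hb) ht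
  refine (measureReal_mono ?_).trans ((measureReal_union_le _ _).trans
    ((add_le_add h1 h2).trans_eq (two_mul _).symm))
  intro ψ hψ
  rcases lt_abs.1 (show t < |_| from hψ) with h | h
  · exact Or.inl h
  · refine Or.inr ?_
    simp only [Set.mem_ofPred_eq, LinearMap.neg_apply, inner_neg_right, map_neg, Complex.neg_re]
    linarith [neg_div (Module.finrank ℂ E : ℝ) (LinearMap.trace ℂ E T).re]

/-- Concentration of the expectation of a bounded operator. -/
theorem uniformSphere_operator_tail (T : E →ₗ[ℂ] E) {R t : ℝ}
    (hR : 0 < R) (hb : ∀ x, ‖inner ℂ x (T x)‖ ≤ R * ‖x‖ ^ 2) (ht : 0 < t) :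
    (uniformSphere μ).real {ψ | t < ‖inner ℂ (ψ : E) (T ψ) -
        LinearMap.trace ℂ E T / Module.finrank ℂ E‖} ≤
      4 * Real.exp (-(Module.finrank ℂ E * t ^ 2 / (512 * R ^ 2))) := by
  have := isProbabilityMeasure_uniformSphere μ
  have hadj : ∀ x, inner ℂ x (T.adjoint x) = star (inner ℂ x (T x)) := by
    intro x
    rw [LinearMap.adjoint_inner_right]
    exact (inner_conj_symm _ _).symm
  -- $P$ and $Q$ are the self-adjoint real and imaginary parts of $T$. Each is tested at threshold
  -- $t/2$, which turns $128$ into $512$.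
  set P : E →ₗ[ℂ] E := (2⁻¹ : ℂ) • (T + T.adjoint) with hP
  set Q : E →ₗ[ℂ] E := (-(Complex.I / 2)) • (T - T.adjoint) with hQ
  have hPi : ∀ x, inner ℂ x (P x) = ((inner ℂ x (T x)).re : ℂ) := by
    intro x
    simp only [hP, LinearMap.smul_apply, LinearMap.add_apply, inner_smul_right, inner_add_right,
      hadj]
    generalize inner ℂ x (T x) = z
    apply Complex.ext <;> simp <;> ring
  have hQi : ∀ x, inner ℂ x (Q x) = ((inner ℂ x (T x)).im : ℂ) := by
    intro x
    simp only [hQ, LinearMap.smul_apply, LinearMap.sub_apply, inner_smul_right, inner_sub_right,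
      hadj]
    generalize inner ℂ x (T x) = z
    apply Complex.ext <;> simp <;> ring
  have hPt : (LinearMap.trace ℂ E P).re = (LinearMap.trace ℂ E T).re := by
    rw [P.trace_eq_sum_inner (stdOrthonormalBasis ℂ E),
      T.trace_eq_sum_inner (stdOrthonormalBasis ℂ E)]
    simp only [hPi, Complex.re_sum, Complex.ofReal_re]
  have hQt : (LinearMap.trace ℂ E Q).re = (LinearMap.trace ℂ E T).im := by
    rw [Q.trace_eq_sum_inner (stdOrthonormalBasis ℂ E),
      T.trace_eq_sum_inner (stdOrthonormalBasis ℂ E)]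
    simp only [hQi, Complex.re_sum, Complex.im_sum, Complex.ofReal_re]
  have hPs : P.IsSymmetric := by
    rw [LinearMap.isSymmetric_iff_inner_map_self_real]
    intro x
    rw [← inner_conj_symm, hPi]; simp
  have hQs : Q.IsSymmetric := by
    rw [LinearMap.isSymmetric_iff_inner_map_self_real]
    intro x
    rw [← inner_conj_symm, hQi]; simp
  have hPb : ∀ x, ‖inner ℂ x (P x)‖ ≤ R * ‖x‖ ^ 2 := fun x ↦ by
    rw [hPi, Complex.norm_real]
    exact (Complex.abs_re_le_norm _).trans (hb x)
  have hQb : ∀ x, ‖inner ℂ x (Q x)‖ ≤ R * ‖x‖ ^ 2 := fun x ↦ by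
    rw [hQi, Complex.norm_real]
    exact (Complex.abs_im_le_norm _).trans (hb x)
  have h1 := uniformSphere_symmetric_abs_tail μ P hPs hR hPb (half_pos ht)
  have h2 := uniformSphere_symmetric_abs_tail μ Q hQs hR hQb (half_pos ht)
  have hexp : Module.finrank ℂ E * (t / 2) ^ 2 / (128 * R ^ 2) =
      Module.finrank ℂ E * t ^ 2 / (512 * R ^ 2) := by field_simp; ring
  rw [hexp] at h1 h2
  refine (measureReal_mono ?_).trans ((measureReal_union_le _ _).trans
    ((add_le_add h1 h2).trans_eq (by ring)))
  intro ψ hψ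
  by_contra hcon
  simp only [Set.mem_union, Set.mem_ofPred_eq, not_or, not_lt, hPi, hQi, hPt, hQt,
    Complex.ofReal_re] at hcon
  have hψ' : t < ‖inner ℂ (ψ : E) (T ψ) - LinearMap.trace ℂ E T / Module.finrank ℂ E‖ := hψ
  have h3 := Complex.norm_le_abs_re_add_abs_im
    (inner ℂ (ψ : E) (T ψ) - LinearMap.trace ℂ E T / Module.finrank ℂ E)
  simp only [Complex.sub_re, Complex.sub_im, Complex.div_natCast_re, Complex.div_natCast_im] at h3
  linarith [hcon.1, hcon.2]

end Sphere

/-! ### Moments of occupation numbers over multisets -/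

section Occupation

variable {α : Type*} [DecidableEq α]

/-- The occupation number of the level `j` in a multiset of levels. -/
def occ {n : ℕ} (s : Sym α n) (j : α) : ℝ := ((s : Multiset α).count j : ℝ)

theorem occ_cons_self {n : ℕ} (s : Sym α n) (j : α) : occ (j ::ₛ s) j = occ s j + 1 := by
  rw [occ, Sym.coe_cons, Multiset.count_cons_self, Nat.cast_succ, occ]

theorem occ_cons_of_ne {n : ℕ} (s : Sym α n) {i j : α} (h : i ≠ j) :
    occ (j ::ₛ s) i = occ s i := by
  rw [occ, Sym.coe_cons, Multiset.count_cons_of_ne h, occ]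

theorem occ_zero (s : Sym α 0) (j : α) : occ s j = 0 := by
  rw [Sym.eq_nil_of_card_zero s, occ, Sym.coe_nil]
  simp

variable [Fintype α]

theorem sum_occ {n : ℕ} (s : Sym α n) : ∑ j, occ s j = n := by
  have h : ∑ j, (s : Multiset α).count j = n := by
    rw [Multiset.sum_count_eq_card fun a _ ↦ Finset.mem_univ a, s.card_coe]
  simp only [occ]
  exact_mod_cast h

/-- Multisets without $j$ contribute nothing, and the others arise uniquely by adding one $j$ to a
smaller multiset. This recursion in $n$ drives all the moment computations. -/
theorem sum_occ_mul (n : ℕ) (j : α) (F : Sym α (n + 1) → ℝ) :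
    ∑ s, occ s j * F s = ∑ t : Sym α n, (occ t j + 1) * F (j ::ₛ t) := by
  symm
  refine Finset.sum_of_injOn (fun t ↦ j ::ₛ t) ?_ (fun _ _ ↦ Finset.mem_coe.2 (Finset.mem_univ _))
    ?_ ?_
  · intro t _ t' _ h
    exact (Sym.cons_inj_right _ _ _).1 h
  · intro s _ hs
    have : j ∉ s := by
      intro hj
      obtain ⟨t, rfl⟩ := Sym.exists_cons_of_mem hj
      exact hs ⟨t, by simp, rfl⟩
    have : (s : Multiset α).count j = 0 := Multiset.count_eq_zero.2 this
    simp [occ, this]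
  · intro t _
    rw [occ_cons_self]

variable [Nonempty α]

theorem card_sym_succ_mul (n : ℕ) :
    ((n : ℝ) + 1) * Fintype.card (Sym α (n + 1)) =
      (n + Fintype.card α) * Fintype.card (Sym α n) := by
  obtain ⟨M, hM⟩ : ∃ M, Fintype.card α = M + 1 :=
    ⟨_, (Nat.succ_pred_eq_of_pos Fintype.card_pos).symm⟩
  rw [Sym.card_sym_eq_choose, Sym.card_sym_eq_choose, hM]
  have h := Nat.add_one_mul_choose_eq (M + n) n
  have e1 : M + 1 + (n + 1) - 1 = M + n + 1 := by omega
  have e2 : M + 1 + n - 1 = M + n := by omega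
  rw [e1, e2]
  have h' : ((M + n + 1 : ℕ) : ℝ) * ((M + n).choose n : ℝ) =
      ((M + n + 1).choose (n + 1) : ℝ) * ((n + 1 : ℕ) : ℝ) := by exact_mod_cast h
  push_cast at h' ⊢
  linarith

theorem sum_occ_eq (n : ℕ) (j : α) :
    (Fintype.card α : ℝ) * ∑ s : Sym α n, occ s j = n * Fintype.card (Sym α n) := by
  induction n with
  | zero => simp [occ_zero]
  | succ n ih =>
    have h := sum_occ_mul n j fun _ ↦ 1
    simp only [mul_one, Finset.sum_add_distrib, Finset.sum_const, Finset.card_univ,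
      nsmul_eq_mul] at h
    have := card_sym_succ_mul (α := α) n
    push_cast
    rw [h, mul_add, ih]
    linarith

theorem sum_occ_sq_eq (n : ℕ) (j : α) :
    (Fintype.card α : ℝ) * (Fintype.card α + 1) * ∑ s : Sym α n, occ s j ^ 2 =
      (2 * n * (n - 1) + n * (Fintype.card α + 1)) * Fintype.card (Sym α n) := by
  induction n with
  | zero => simp [occ_zero]
  | succ n ih =>
    have h := sum_occ_mul n j fun s ↦ occ s j
    have e : ∀ t : Sym α n, (occ t j + 1) * (occ t j + 1) = occ t j ^ 2 + 2 * occ t j + 1 :=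
      fun t ↦ by ring
    simp only [occ_cons_self, e, ← sq, Finset.sum_add_distrib, Finset.sum_const, Finset.card_univ,
      nsmul_eq_mul, ← Finset.mul_sum, mul_one] at h
    have h1 := card_sym_succ_mul (α := α) n
    have h2 := sum_occ_eq n j
    push_cast
    rw [h]
    linear_combination ih + 2 * (Fintype.card α + 1 : ℝ) * h2 -
      (2 * n + Fintype.card α + 1 : ℝ) * h1

theorem sum_occ_mul_occ_eq (n : ℕ) {i j : α} (hij : i ≠ j) :
    (Fintype.card α : ℝ) * (Fintype.card α + 1) * ∑ s : Sym α n, occ s j * occ s i =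
      n * (n - 1) * Fintype.card (Sym α n) := by
  induction n with
  | zero => simp [occ_zero]
  | succ n ih =>
    have h := sum_occ_mul n j fun s ↦ occ s i
    simp only [occ_cons_of_ne _ hij, add_mul, one_mul, Finset.sum_add_distrib] at h
    have h1 := card_sym_succ_mul (α := α) n
    have h2 := sum_occ_eq n i
    push_cast
    rw [h]
    linear_combination ih + (Fintype.card α + 1 : ℝ) * h2 - (n : ℝ) * h1

/-- The level energies of a diagonal collective Hamiltonian spread over a range of order `n`. -/
theorem le_variance_occ (n : ℕ) (v : α → ℝ) {j j' : α} (hj : j ≠ j') :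
    (Fintype.card (Sym α n) : ℝ) ^ 2 * ((v j - v j') ^ 2 * n ^ 2 /
        (2 * Fintype.card α * (Fintype.card α + 1))) ≤
      Fintype.card (Sym α n) * ∑ s : Sym α n, (∑ i, v i * occ s i) ^ 2 -
        (∑ s : Sym α n, ∑ i, v i * occ s i) ^ 2 := by
  set N : ℝ := (Fintype.card α : ℝ)
  have hN : 0 < N := Nat.cast_pos.2 Fintype.card_pos
  set a : ℝ := (Fintype.card (Sym α n) : ℝ) with ha
  have hapos : 0 < a := by
    have : Nonempty (Sym α n) := ⟨Sym.replicate n j⟩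
    exact Nat.cast_pos.2 Fintype.card_pos
  set e : Sym α n → ℝ := fun s ↦ ∑ i, v i * occ s i with he
  set m := (∑ s, e s) / a with hm
  set W := ∑ s : Sym α n, (occ s j - occ s j') ^ 2 with hW
  have h1 : ∀ i, N * (N + 1) * ∑ s : Sym α n, occ s i ^ 2 = (2 * n * (n - 1) + n * (N + 1)) * a :=
    fun i ↦ sum_occ_sq_eq n i
  have h2 : ∀ i i', i ≠ i' → N * (N + 1) * ∑ s : Sym α n, occ s i' * occ s i = n * (n - 1) * a :=
    fun i i' h ↦ sum_occ_mul_occ_eq n h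
  have hWexp : W = ∑ s : Sym α n, occ s j ^ 2 - 2 * ∑ s : Sym α n, occ s j' * occ s j +
      ∑ s : Sym α n, occ s j' ^ 2 := by
    rw [hW, Finset.mul_sum, ← Finset.sum_sub_distrib, ← Finset.sum_add_distrib]
    exact Finset.sum_congr rfl fun s _ ↦ by ring
  have hWval : N * (N + 1) * W = 2 * n * (n + N) * a := by
    rw [hWexp]
    linear_combination h1 j + h1 j' - 2 * h2 j j' hj
  have hw0 : ∑ s : Sym α n, (occ s j - occ s j') = 0 := by
    rw [Finset.sum_sub_distrib]
    have := sum_occ_eq n j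
    have := sum_occ_eq n j'
    have : N * (∑ s : Sym α n, occ s j - ∑ s : Sym α n, occ s j') = 0 := by linarith
    exact (mul_eq_zero.1 this).resolve_left hN.ne'
  -- The difference $n_j-n_{j'}$ is uncorrelated with every other occupation number. Its covariance
  -- with the energy therefore sees only $v_j-v_{j'}$, and Cauchy–Schwarz against it bounds the
  -- energy variance below.
  have hkw : ∀ i, ∑ s : Sym α n, occ s i * (occ s j - occ s j') =
      (if i = j then W / 2 else 0) - (if i = j' then W / 2 else 0) := by
    intro i
    have hNN : N * (N + 1) ≠ 0 := by positivity
    apply mul_left_cancel₀ hNN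
    simp only [mul_sub, Finset.sum_sub_distrib]
    by_cases h : i = j
    · subst h
      have := h1 i
      have h4 := h2 j' i hj.symm
      simp only [sq] at this
      simp only [if_true, if_neg hj]
      linear_combination this - h4 - hWval / 2
    · by_cases h' : i = j'
      · subst h'
        have := h1 i
        have h4 := h2 j i hj
        simp only [sq] at this
        simp only [if_true, if_neg h]
        linear_combination -this + h4 + hWval / 2
      · have h4 := h2 j i (Ne.symm h)
        have h5 := h2 j' i (Ne.symm h')
        simp only [if_neg h, if_neg h']
        linear_combination h4 - h5
  have hew : ∑ s : Sym α n, (e s - m) * (occ s j - occ s j') = (v j - v j') * (W / 2) := by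
    have : ∀ s : Sym α n, (e s - m) * (occ s j - occ s j') =
        ∑ i, v i * (occ s i * (occ s j - occ s j')) - m * (occ s j - occ s j') := by
      intro s
      rw [sub_mul, he, Finset.sum_mul]
      congr 1
      exact Finset.sum_congr rfl fun i _ ↦ by ring
    simp only [this]
    rw [Finset.sum_sub_distrib, ← Finset.mul_sum, hw0, Finset.sum_comm]
    simp only [← Finset.mul_sum, hkw]
    simp only [mul_sub, Finset.sum_sub_distrib, mul_ite, mul_zero,
      Finset.sum_ite_eq', Finset.mem_univ, if_true]
    ring
  have hCS := Finset.sum_mul_sq_le_sq_mul_sq Finset.univ (fun s ↦ e s - m)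
    fun s : Sym α n ↦ occ s j - occ s j'
  rw [hew] at hCS
  change _ ≤ _ * W at hCS
  have hVS : a * ∑ s, (e s - m) ^ 2 = a * ∑ s, e s ^ 2 - (∑ s, e s) ^ 2 := by
    have : ∀ s, (e s - m) ^ 2 = e s ^ 2 - 2 * m * e s + m ^ 2 := fun s ↦ by ring
    simp only [this, Finset.sum_add_distrib, Finset.sum_sub_distrib, ← Finset.mul_sum,
      Finset.sum_const, Finset.card_univ, nsmul_eq_mul, ← ha]
    rw [hm]; field_simp; ring
  change _ ≤ a * ∑ s, e s ^ 2 - (∑ s, e s) ^ 2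
  rw [← hVS]
  have hW0 : 0 ≤ W := Finset.sum_nonneg fun s _ ↦ sq_nonneg _
  have hlow : (v j - v j') ^ 2 * W / 4 ≤ ∑ s, (e s - m) ^ 2 := by
    -- $W=0$ does occur, for $n=0$, and then there is nothing to divide by.
    rcases hW0.eq_or_lt with h | h
    · rw [← h]
      simpa using Finset.sum_nonneg fun s _ ↦ sq_nonneg (e s - m)
    · refine le_of_mul_le_mul_right ?_ h
      refine le_trans (le_of_eq ?_) hCS
      ring
  calc a ^ 2 * ((v j - v j') ^ 2 * n ^ 2 / (2 * N * (N + 1)))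
      ≤ a ^ 2 * ((v j - v j') ^ 2 * (n * (n + N)) / (2 * N * (N + 1))) := by
        gcongr
        nlinarith [Nat.cast_nonneg (α := ℝ) n]
    _ = a * ((v j - v j') ^ 2 * W / 4) := by
        have : W = 2 * n * (n + N) * a / (N * (N + 1)) := by
          rw [eq_div_iff (by positivity)]; linarith
        rw [this]; field_simp; ring
    _ ≤ _ := by gcongr

end Occupation

/-! ### Words up to permutation -/

section Types

variable {n d : ℕ}

/-- The multiset of letters of a word. -/
def wordType (x : Fin n → Fin d) : Sym (Fin d) n := ⟨(List.ofFn x : Multiset (Fin d)), by simp⟩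

theorem wordType_comp (x : Fin n → Fin d) (π : Equiv.Perm (Fin n)) :
    wordType (x ∘ π) = wordType x :=
  Subtype.ext (Multiset.coe_eq_coe.2 (π.ofFn_comp_perm x))

/-- Two words with the same letters have the same sorted word, so composing one sorting permutation
with the inverse of the other relates them. -/
theorem exists_perm_of_wordType_eq {x y : Fin n → Fin d} (h : wordType x = wordType y) :
    ∃ π : Equiv.Perm (Fin n), y = x ∘ π := by
  have hp : (List.ofFn x).Perm (List.ofFn y) := Multiset.coe_eq_coe.1 (congrArg Subtype.val h)
  have hs : x ∘ Tuple.sort x = y ∘ Tuple.sort y := by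
    refine List.ofFn_injective ?_
    exact ((((Tuple.sort x).ofFn_comp_perm x).trans hp).trans
      ((Tuple.sort y).ofFn_comp_perm y).symm).eq_of_pairwise'
        (Tuple.monotone_sort x).sortedLE_ofFn.pairwise
        (Tuple.monotone_sort y).sortedLE_ofFn.pairwise
  refine ⟨(Tuple.sort y).symm.trans (Tuple.sort x), ?_⟩
  ext i
  have := congrFun hs ((Tuple.sort y).symm i)
  simp only [Function.comp_apply, Equiv.apply_symm_apply] at this
  simp [this]

theorem wordType_surjective : Function.Surjective (wordType (n := n) (d := d)) := by
  rintro ⟨m, hm⟩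
  induction m using Quotient.inductionOn with
  | _ l =>
    have hl : l.length = n := hm
    subst hl
    refine ⟨l.get, Subtype.ext ?_⟩
    simp [wordType]

theorem sum_comp_eq_sum_occ (v : Fin d → ℝ) (x : Fin n → Fin d) :
    ∑ i, v (x i) = ∑ j, v j * occ (wordType x) j := by
  have h1 : ∑ i, v (x i) = ((List.ofFn x : Multiset (Fin d)).map v).sum := by
    simp [List.sum_ofFn, List.map_ofFn]
  rw [h1, Finset.sum_multiset_map_count]
  refine (Finset.sum_subset (Finset.subset_univ _) fun j _ hj ↦ ?_).trans
    (Finset.sum_congr rfl fun j _ ↦ ?_)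
  · rw [Multiset.mem_toFinset] at hj
    simp [Multiset.count_eq_zero.2 hj]
  · rw [nsmul_eq_mul, mul_comm]
    rfl

end Types

/-! ### Product vectors and the occupation basis of the symmetric subspace -/

section Tensor

variable {n d : ℕ}

/-- The product vector `f₁ ⊗ ⋯ ⊗ fₙ`. -/
def prodVec (f : Fin n → EuclideanSpace ℂ (Fin d)) : Qudits n d :=
  WithLp.toLp 2 fun x ↦ ∏ i, f i (x i)

theorem inner_prodVec (f g : Fin n → EuclideanSpace ℂ (Fin d)) :
    inner ℂ (prodVec f) (prodVec g) = ∏ i, inner ℂ (f i) (g i) := by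
  simp only [PiLp.inner_apply, prodVec]
  rw [Finset.prod_univ_sum, Fintype.piFinset_univ]
  refine Finset.sum_congr rfl fun x _ ↦ ?_
  simp [Finset.prod_mul_distrib]

theorem toEuclideanLin_tensorOp_prodVec (M : Fin n → Matrix (Fin d) (Fin d) ℂ)
    (f : Fin n → EuclideanSpace ℂ (Fin d)) :
    Matrix.toEuclideanLin (tensorOp M) (prodVec f) =
      prodVec fun i ↦ Matrix.toEuclideanLin (M i) (f i) := by
  ext x
  simp only [Matrix.toLpLin_apply, prodVec, Matrix.mulVec, dotProduct, tensorOp,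
    Matrix.of_apply]
  rw [Finset.prod_univ_sum, Fintype.piFinset_univ]
  exact Finset.sum_congr rfl fun y _ ↦ Finset.prod_mul_distrib.symm

theorem toEuclideanLin_permOp_apply (π : Equiv.Perm (Fin n)) (ψ : Qudits n d)
    (x : Fin n → Fin d) : Matrix.toEuclideanLin (permOp d π) ψ x = ψ (x ∘ π) := by
  simp [Matrix.toLpLin_apply, Matrix.mulVec, dotProduct, permOp]

theorem toEuclideanLin_permOp_prodVec (π : Equiv.Perm (Fin n))
    (f : Fin n → EuclideanSpace ℂ (Fin d)) :
    Matrix.toEuclideanLin (permOp d π) (prodVec f) = prodVec (f ∘ π.symm) := by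
  ext x
  rw [toEuclideanLin_permOp_apply]
  simp only [prodVec, Function.comp_apply]
  rw [← Equiv.prod_comp π fun i ↦ f (π.symm i) (x i)]
  simp

theorem mem_symSpace {ψ : Qudits n d} :
    ψ ∈ symSpace n d ↔ ∀ π, Matrix.toEuclideanLin (permOp d π) ψ = ψ := by
  simp [symSpace, Submodule.mem_iInf, LinearMap.mem_eqLocus]

theorem apply_eq_of_wordType_eq {ψ : Qudits n d} (hψ : ψ ∈ symSpace n d) {x y : Fin n → Fin d}
    (h : wordType x = wordType y) : ψ x = ψ y := by
  obtain ⟨π, rfl⟩ := exists_perm_of_wordType_eq h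
  rw [← toEuclideanLin_permOp_apply, mem_symSpace.1 hψ π]

/-- A symmetric vector is determined by one coordinate per type. This upper bound makes the
orthonormal occupation vectors a basis. -/
theorem finrank_symSpace_le : Module.finrank ℂ (symSpace n d) ≤ Fintype.card (Sym (Fin d) n) := by
  let rep : Sym (Fin d) n → (Fin n → Fin d) := Function.surjInv wordType_surjective
  let f : symSpace n d →ₗ[ℂ] (Sym (Fin d) n → ℂ) :=
    { toFun := fun ψ s ↦ (ψ : Qudits n d) (rep s)
      map_add' := fun _ _ ↦ rfl
      map_smul' := fun _ _ ↦ rfl }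
  have hf : Function.Injective f := by
    rw [← LinearMap.ker_eq_bot, LinearMap.ker_eq_bot']
    intro ψ h
    ext x
    have h1 := congrFun h (wordType x)
    have h2 : wordType (rep (wordType x)) = wordType x := Function.surjInv_eq _ _
    exact (apply_eq_of_wordType_eq ψ.2 h2).symm.trans h1
  simpa using LinearMap.finrank_le_finrank_of_injective hf

variable (φ : OrthonormalBasis (Fin d) ℂ (EuclideanSpace ℂ (Fin d)))

theorem inner_prodVec_basis (x y : Fin n → Fin d) :
    inner ℂ (prodVec fun i ↦ φ (x i)) (prodVec fun i ↦ φ (y i)) = if x = y then 1 else 0 := by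
  rw [inner_prodVec]
  simp only [φ.inner_eq_ite]
  rw [Fintype.prod_ite_zero]
  simp [funext_iff]

/-- The normalized symmetrization of the product vectors of type `s`. -/
def occVec (s : Sym (Fin d) n) : Qudits n d :=
  (((√((Finset.univ.filter fun x : Fin n → Fin d ↦ wordType x = s).card : ℝ))⁻¹ : ℝ) : ℂ) •
    ∑ x with wordType x = s, prodVec fun i ↦ φ (x i)

theorem occVec_mem (s : Sym (Fin d) n) : occVec φ s ∈ symSpace n d := by
  rw [mem_symSpace]
  intro π
  rw [occVec, map_smul, map_sum]
  congr 1
  refine Finset.sum_bij' (fun x _ ↦ x ∘ π.symm) (fun x _ ↦ x ∘ π) ?_ ?_ ?_ ?_ ?_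
  · intro x hx
    simpa [wordType_comp] using hx
  · intro x hx
    simpa [wordType_comp] using hx
  · intro x _; ext i; simp
  · intro x _; ext i; simp
  · intro x _
    rw [toEuclideanLin_permOp_prodVec]
    rfl

theorem orthonormal_occVec : Orthonormal ℂ (occVec (n := n) φ) := by
  rw [orthonormal_iff_ite]
  intro s t
  simp only [occVec, inner_smul_left, inner_smul_right, sum_inner, inner_sum, inner_prodVec_basis,
    Complex.conj_ofReal, ← Finset.mul_sum]
  by_cases h : s = t
  · subst h
    rw [if_pos rfl]
    have h0 : (0 : ℝ) < (Finset.univ.filter fun x : Fin n → Fin d ↦ wordType x = s).card := by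
      obtain ⟨x, hx⟩ := wordType_surjective s
      exact_mod_cast Finset.card_pos.2 ⟨x, by simp [hx]⟩
    have h1 : ∑ x with wordType x = s, ∑ y with wordType y = s, (if y = x then (1 : ℂ) else 0) =
        ((Finset.univ.filter fun x : Fin n → Fin d ↦ wordType x = s).card : ℝ) := by
      rw [Finset.sum_congr rfl fun x hx ↦ by rw [Finset.sum_ite_eq', if_pos hx]]
      simp
    rw [h1, ← Complex.ofReal_mul, ← Complex.ofReal_mul, ← Complex.ofReal_one]
    congr 1
    rw [← mul_assoc, ← mul_inv, Real.mul_self_sqrt h0.le, inv_mul_cancel₀ h0.ne']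
  · rw [if_neg h, Finset.sum_eq_zero, mul_zero, mul_zero]
    intro x hx
    refine Finset.sum_eq_zero fun y hy ↦ if_neg ?_
    rintro rfl
    simp only [Finset.mem_filter, Finset.mem_univ, true_and] at hx hy
    exact h (hy.symm.trans hx)

/-- The occupation number basis of the symmetric subspace. -/
def occBasis : OrthonormalBasis (Sym (Fin d) n) ℂ (symSpace n d) := by
  have hon : Orthonormal ℂ fun s ↦ (⟨occVec φ s, occVec_mem φ s⟩ : symSpace n d) := by
    have h := orthonormal_occVec (n := n) φ
    rw [orthonormal_iff_ite] at h ⊢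
    exact h
  refine OrthonormalBasis.mk hon (ge_of_eq ?_)
  refine hon.linearIndependent.span_eq_top_of_card_eq_finrank' (le_antisymm ?_ ?_)
  · exact hon.linearIndependent.fintype_card_le_finrank
  · exact finrank_symSpace_le

theorem occBasis_apply (s : Sym (Fin d) n) : (occBasis φ s : Qudits n d) = occVec φ s := by
  simp [occBasis]

theorem finrank_symSpace : Module.finrank ℂ (symSpace n d) = Fintype.card (Sym (Fin d) n) :=
  Module.finrank_eq_card_basis (occBasis (EuclideanSpace.basisFun (Fin d) ℂ)).toBasis

theorem finrank_symSpace_eq_choose :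
    Module.finrank ℂ (symSpace n d) = (n + d - 1).choose n := by
  rw [finrank_symSpace, Sym.card_sym_eq_choose, Fintype.card_fin, add_comm]

theorem toEuclideanLin_levelHam (v : Fin d → ℝ) (j : Fin d) :
    Matrix.toEuclideanLin (levelHam φ v) (φ j) = (v j : ℂ) • φ j := by
  have h : ∀ k, Matrix.toEuclideanLin (Matrix.of fun a b ↦ φ k a * star (φ k b)) (φ j) =
      (if k = j then (1 : ℂ) else 0) • φ k := by
    intro k
    rw [← φ.inner_eq_ite k j]
    ext a
    simp only [Matrix.toLpLin_apply, Matrix.mulVec, dotProduct, Matrix.of_apply,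
      PiLp.smul_apply, PiLp.inner_apply, smul_eq_mul, Finset.sum_mul]
    refine Finset.sum_congr rfl fun b _ ↦ ?_
    simp only [RCLike.inner_apply, RCLike.star_def]
    ring
  rw [levelHam, map_sum, LinearMap.sum_apply]
  simp only [map_smul, LinearMap.smul_apply, h]
  simp

theorem toEuclideanLin_siteOp_prodVec (i : Fin n) (h : Matrix (Fin d) (Fin d) ℂ)
    (f : Fin n → EuclideanSpace ℂ (Fin d)) :
    Matrix.toEuclideanLin (siteOp i h) (prodVec f) =
      prodVec (Function.update f i (Matrix.toEuclideanLin h (f i))) := by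
  rw [siteOp, toEuclideanLin_tensorOp_prodVec]
  congr 1
  ext k
  by_cases hk : k = i
  · subst hk; simp
  · simp [hk]

theorem prodVec_update_smul (f : Fin n → EuclideanSpace ℂ (Fin d)) (i : Fin n) (c : ℂ) :
    prodVec (Function.update f i (c • f i)) = c • prodVec f := by
  ext x
  simp only [prodVec, PiLp.smul_apply, smul_eq_mul]
  rw [← Finset.mul_prod_erase Finset.univ _ (Finset.mem_univ i),
    ← Finset.mul_prod_erase Finset.univ (fun k ↦ f k (x k)) (Finset.mem_univ i)]
  simp only [Function.update_self, PiLp.smul_apply, smul_eq_mul, mul_assoc]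
  congr 2
  refine Finset.prod_congr rfl fun k hk ↦ ?_
  rw [Function.update_of_ne (Finset.ne_of_mem_erase hk)]

/-- The occupation vectors diagonalize the collective Hamiltonians of their one-particle basis. -/
theorem linearHam_occVec (v : Fin d → ℝ) (s : Sym (Fin d) n) :
    Matrix.toEuclideanLin (linearHam fun _ : Fin n ↦ levelHam φ v) (occVec φ s) =
      ((∑ j, v j * occ s j : ℝ) : ℂ) • occVec φ s := by
  rw [occVec, map_smul, smul_comm, Finset.smul_sum, map_sum]
  congr 1
  refine Finset.sum_congr rfl fun x hx ↦ ?_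
  have hx' : wordType x = s := by simpa using hx
  rw [linearHam, map_sum, LinearMap.sum_apply]
  simp only [toEuclideanLin_siteOp_prodVec, toEuclideanLin_levelHam]
  have : ∀ i, prodVec (Function.update (fun i ↦ φ (x i)) i ((v (x i) : ℂ) • φ (x i))) =
      (v (x i) : ℂ) • prodVec fun i ↦ φ (x i) := fun i ↦
    prodVec_update_smul (fun i ↦ φ (x i)) i _
  simp only [this]
  rw [← Finset.sum_smul, ← Complex.ofReal_sum, sum_comp_eq_sum_occ, hx']

end Tensor

/-! ### Permutation averages and collective operators -/

section Operators

variable {n d : ℕ}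

theorem toEuclideanLin_mul_apply (M N : Op n d) (ψ : Qudits n d) :
    Matrix.toEuclideanLin (M * N) ψ = Matrix.toEuclideanLin M (Matrix.toEuclideanLin N ψ) := by
  rw [Matrix.toLpLin_mul_same, LinearMap.comp_apply]

theorem inner_toEuclideanLin_conjTranspose (M : Op n d) (ψ χ : Qudits n d) :
    inner ℂ (Matrix.toEuclideanLin M.conjTranspose ψ) χ = inner ℂ ψ (Matrix.toEuclideanLin M χ) := by
  rw [Matrix.toEuclideanLin_conjTranspose_eq_adjoint, LinearMap.adjoint_inner_left]

theorem permOp_conjTranspose (π : Equiv.Perm (Fin n)) :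
    (permOp d π).conjTranspose = permOp d π⁻¹ := by
  ext x y
  have : x = y ∘ π ↔ y = x ∘ (π⁻¹ : Equiv.Perm (Fin n)) := by
    constructor <;> rintro rfl <;> ext i <;> simp
  simp only [Matrix.conjTranspose_apply, permOp, Matrix.of_apply, this]
  split_ifs <;> simp

theorem norm_toEuclideanLin_permOp (π : Equiv.Perm (Fin n)) (ψ : Qudits n d) :
    ‖Matrix.toEuclideanLin (permOp d π) ψ‖ = ‖ψ‖ := by
  rw [EuclideanSpace.norm_eq, EuclideanSpace.norm_eq]
  congr 1
  simp only [toEuclideanLin_permOp_apply]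
  exact Equiv.sum_comp (Equiv.arrowCongr π.symm (Equiv.refl (Fin d))) fun x ↦ ‖ψ x‖ ^ 2

theorem permOp_conj_apply (π : Equiv.Perm (Fin n)) (M : Op n d) (x y : Fin n → Fin d) :
    (permOp d π * M * (permOp d π).conjTranspose) x y = M (x ∘ π) (y ∘ π) := by
  simp [Matrix.mul_apply, permOp, Matrix.conjTranspose_apply, apply_ite star]

theorem toEuclideanLin_twirl_apply (H : Op n d) {ψ : Qudits n d} (hψ : ψ ∈ symSpace n d) :
    Matrix.toEuclideanLin (twirl H) ψ = ((n.factorial : ℂ)⁻¹) •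
      ∑ π, Matrix.toEuclideanLin (permOp d π) (Matrix.toEuclideanLin H ψ) := by
  rw [twirl, map_smul, map_sum, LinearMap.smul_apply, LinearMap.sum_apply]
  congr 1
  refine Finset.sum_congr rfl fun π _ ↦ ?_
  rw [toEuclideanLin_mul_apply, toEuclideanLin_mul_apply, permOp_conjTranspose,
    mem_symSpace.1 hψ]

/-- On a symmetric vector, $V(\pi)HV(\pi)^\dagger\psi=V(\pi)H\psi$. Thus $H_S\psi$ is an average of
vectors of norm $\|H\psi\|$. -/
theorem norm_toEuclideanLin_twirl_le (H : Op n d) {ψ : Qudits n d} (hψ : ψ ∈ symSpace n d) :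
    ‖Matrix.toEuclideanLin (twirl H) ψ‖ ≤ ‖Matrix.toEuclideanLin H ψ‖ := by
  rw [toEuclideanLin_twirl_apply H hψ, norm_smul, norm_inv, Complex.norm_natCast]
  have h0 : (0 : ℝ) < n.factorial := by exact_mod_cast n.factorial_pos
  rw [inv_mul_le_iff₀ h0]
  refine (norm_sum_le _ _).trans (le_of_eq ?_)
  simp only [norm_toEuclideanLin_permOp]
  simp [Fintype.card_perm]

theorem inner_toEuclideanLin_twirl (H : Op n d) {ψ : Qudits n d} (hψ : ψ ∈ symSpace n d) :
    inner ℂ ψ (Matrix.toEuclideanLin (twirl H) ψ) = inner ℂ ψ (Matrix.toEuclideanLin H ψ) := by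
  rw [toEuclideanLin_twirl_apply H hψ, inner_smul_right, inner_sum]
  simp only [← inner_toEuclideanLin_conjTranspose, permOp_conjTranspose, mem_symSpace.1 hψ]
  have h0 : (n.factorial : ℂ) ≠ 0 := by exact_mod_cast n.factorial_ne_zero
  simp [Fintype.card_perm, h0]

theorem isHermitian_twirl {H : Op n d} (hH : H.IsHermitian) : (twirl H).IsHermitian := by
  ext x y
  have h : ∀ x y, star (H x y) = H y x := fun x y ↦ hH.apply y x
  simp only [twirl, Matrix.conjTranspose_apply, Matrix.smul_apply, Matrix.sum_apply,
    permOp_conj_apply, star_smul, star_sum, h]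
  simp

theorem qfi_eq_of_isHermitian {H : Op n d} (hH : H.IsHermitian) (ψ : Qudits n d) :
    qfi ψ H = 4 * (‖Matrix.toEuclideanLin H ψ‖ ^ 2 -
      (inner ℂ ψ (Matrix.toEuclideanLin H ψ)).re ^ 2) := by
  rw [qfi, toEuclideanLin_mul_apply, ← inner_toEuclideanLin_conjTranspose, hH.eq,
    ← inner_self_eq_norm_sq (𝕜 := ℂ)]
  rfl

/-- Averaging over the permutations does not increase the Fisher information of a symmetric
state. -/
theorem qfi_twirl_le {H : Op n d} (hH : H.IsHermitian) {ψ : Qudits n d} (hψ : ψ ∈ symSpace n d) :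
    qfi ψ (twirl H) ≤ qfi ψ H := by
  rw [qfi_eq_of_isHermitian hH, qfi_eq_of_isHermitian (isHermitian_twirl hH),
    inner_toEuclideanLin_twirl H hψ]
  have := norm_toEuclideanLin_twirl_le H hψ
  gcongr

theorem siteOp_apply (i : Fin n) (h : Matrix (Fin d) (Fin d) ℂ) (x y : Fin n → Fin d) :
    siteOp i h x y =
      h (x i) (y i) * ∏ k ∈ Finset.univ.erase i, (1 : Matrix (Fin d) (Fin d) ℂ) (x k) (y k) := by
  simp only [siteOp, tensorOp, Matrix.of_apply]
  rw [← Finset.mul_prod_erase Finset.univ _ (Finset.mem_univ i), Function.update_self]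
  congr 1
  refine Finset.prod_congr rfl fun k hk ↦ ?_
  rw [Function.update_of_ne (Finset.ne_of_mem_erase hk)]

/-- `siteOp` as a linear map. -/
def siteLin (i : Fin n) : Matrix (Fin d) (Fin d) ℂ →ₗ[ℂ] Op n d where
  toFun := siteOp i
  map_add' h h' := by ext x y; simp [siteOp_apply, add_mul]
  map_smul' c h := by ext x y; simp [siteOp_apply, mul_assoc]

theorem siteLin_apply (i : Fin n) (h : Matrix (Fin d) (Fin d) ℂ) : siteLin i h = siteOp i h := rfl

theorem linearHam_const_sum {ι : Type*} (s : Finset ι) (c : ι → ℂ)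
    (h : ι → Matrix (Fin d) (Fin d) ℂ) :
    (linearHam fun _ : Fin n ↦ ∑ a ∈ s, c a • h a) = ∑ a ∈ s, c a • linearHam fun _ ↦ h a := by
  simp only [linearHam, ← siteLin_apply, map_sum, map_smul, Finset.smul_sum]
  exact Finset.sum_comm

theorem isHermitian_siteOp (i : Fin n) {h : Matrix (Fin d) (Fin d) ℂ} (hh : h.IsHermitian) :
    (siteOp i h).IsHermitian := by
  ext x y
  have h1 : ∀ a b, star (h a b) = h b a := fun a b ↦ hh.apply b a
  simp only [Matrix.conjTranspose_apply, siteOp_apply, star_mul', h1, star_prod]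
  congr 1
  refine Finset.prod_congr rfl fun k _ ↦ ?_
  simp only [Matrix.one_apply, eq_comm (a := y k)]
  split_ifs <;> simp

theorem isHermitian_linearHam {h : Fin n → Matrix (Fin d) (Fin d) ℂ}
    (hh : ∀ i, (h i).IsHermitian) : (linearHam h).IsHermitian := by
  rw [Matrix.IsHermitian, linearHam, Matrix.conjTranspose_sum]
  exact Finset.sum_congr rfl fun i _ ↦ (isHermitian_siteOp i (hh i)).eq

theorem isHermitian_levelHam (φ : OrthonormalBasis (Fin d) ℂ (EuclideanSpace ℂ (Fin d)))
    (v : Fin d → ℝ) : (levelHam φ v).IsHermitian := by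
  ext a b
  simp only [levelHam, Matrix.conjTranspose_apply, Matrix.sum_apply, Matrix.smul_apply,
    Matrix.of_apply, star_sum, smul_eq_mul, star_mul', star_star]
  refine Finset.sum_congr rfl fun j _ ↦ ?_
  simp [mul_comm]

theorem permOp_conj_siteOp (π : Equiv.Perm (Fin n)) (i : Fin n) (h : Matrix (Fin d) (Fin d) ℂ) :
    permOp d π * siteOp i h * (permOp d π).conjTranspose = siteOp (π i) h := by
  ext x y
  rw [permOp_conj_apply]
  simp only [siteOp, tensorOp, Matrix.of_apply, Function.comp_apply]
  rw [← Equiv.prod_comp π fun k ↦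
    Function.update (fun _ ↦ (1 : Matrix (Fin d) (Fin d) ℂ)) (π i) h k (x k) (y k)]
  refine Finset.prod_congr rfl fun k _ ↦ ?_
  by_cases hk : k = i
  · subst hk; simp
  · rw [Function.update_of_ne hk, Function.update_of_ne (fun h ↦ hk (π.injective h))]

theorem twirl_siteOp (i : Fin n) (h : Matrix (Fin d) (Fin d) ℂ) :
    (n : ℂ) • twirl (siteOp i h) = linearHam fun _ ↦ h := by
  have h1 : ∀ k, twirl (siteOp k h) =
      ((n.factorial : ℂ)⁻¹) • ∑ π : Equiv.Perm (Fin n), siteOp (π k) h := fun k ↦ by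
    simp only [twirl, permOp_conj_siteOp]
  have h2 : ∀ k, twirl (siteOp k h) = twirl (siteOp i h) := by
    intro k
    rw [h1, h1]
    congr 1
    -- Reindexing the permutations by right multiplication with the swap of $i$ and $k$ shows that
    -- the average does not depend on the starting site.
    rw [← Equiv.sum_comp (Equiv.mulRight (Equiv.swap i k)) fun π ↦ siteOp (π i) h]
    simp
  have h3 : (n : ℂ) • twirl (siteOp i h) = ∑ k, twirl (siteOp k h) := by
    simp [h2, ← Nat.cast_smul_eq_nsmul ℂ]
  rw [h3]
  simp only [h1, ← Finset.smul_sum]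
  rw [Finset.sum_comm]
  have h4 : ∀ π : Equiv.Perm (Fin n), ∑ k, siteOp (π k) h = linearHam fun _ ↦ h := fun π ↦
    Equiv.sum_comp π fun k ↦ siteOp k h
  have h0 : (n.factorial : ℂ) ≠ 0 := by exact_mod_cast n.factorial_ne_zero
  simp only [h4, Finset.sum_const, Finset.card_univ, Fintype.card_perm, Fintype.card_fin]
  rw [← Nat.cast_smul_eq_nsmul ℂ, smul_smul, inv_mul_cancel₀ h0, one_smul]

theorem twirl_linearHam (hn : n ≠ 0) (h : Fin n → Matrix (Fin d) (Fin d) ℂ) :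
    twirl (linearHam h) = linearHam fun _ ↦ ∑ i, (n : ℂ)⁻¹ • h i := by
  have h0 : (n : ℂ) ≠ 0 := by exact_mod_cast hn
  rw [linearHam_const_sum]
  have h1 : ∀ i, (n : ℂ)⁻¹ • (linearHam fun _ : Fin n ↦ h i) = twirl (siteOp i (h i)) := by
    intro i
    rw [← twirl_siteOp i, smul_smul, inv_mul_cancel₀ h0, one_smul]
  simp only [h1]
  simp only [twirl, linearHam, Finset.mul_sum, Finset.sum_mul, ← Finset.smul_sum]
  rw [Finset.sum_comm]

theorem sum_smul_levelHam (φ : OrthonormalBasis (Fin d) ℂ (EuclideanSpace ℂ (Fin d)))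
    (v : Fin n → Fin d → ℝ) :
    ∑ i, (n : ℂ)⁻¹ • levelHam φ (v i) = levelHam φ fun j ↦ (∑ i, v i j) / n := by
  simp only [levelHam, Finset.smul_sum, smul_smul]
  rw [Finset.sum_comm]
  refine Finset.sum_congr rfl fun j _ ↦ ?_
  rw [← Finset.sum_smul]
  congr 1
  push_cast
  rw [← Finset.mul_sum, div_eq_inv_mul]

theorem norm_levelHam_apply_le (φ : OrthonormalBasis (Fin d) ℂ (EuclideanSpace ℂ (Fin d)))
    {v : Fin d → ℝ} {B : ℝ} (hv : ∀ j, |v j| ≤ B) (a b : Fin d) :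
    ‖levelHam φ v a b‖ ≤ d * B := by
  simp only [levelHam, Matrix.sum_apply, Matrix.smul_apply, Matrix.of_apply, smul_eq_mul]
  have hφ : ∀ j c, ‖φ j c‖ ≤ 1 := fun j c ↦
    (PiLp.norm_apply_le (φ j) c).trans (φ.orthonormal.1 j).le
  calc ‖∑ j, (v j : ℂ) * (φ j a * star (φ j b))‖ ≤ ∑ _j : Fin d, B := by
        refine norm_sum_le_of_le _ fun j _ ↦ ?_
        rw [norm_mul, norm_mul, norm_star, Complex.norm_real]
        calc ‖v j‖ * (‖φ j a‖ * ‖φ j b‖) ≤ ‖v j‖ * (1 * 1) := by gcongr <;> exact hφ _ _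
          _ ≤ B := by simpa using hv j
    _ = d * B := by simp

/-- The collective matrix unit `∑ᵢ |a⟩⟨b|ᵢ`. -/
def unitHam (n : ℕ) {d : ℕ} (p : Fin d × Fin d) : Op n d :=
  linearHam fun _ ↦ Matrix.single p.1 p.2 1

theorem linearHam_const_eq_sum (h : Matrix (Fin d) (Fin d) ℂ) :
    (linearHam fun _ : Fin n ↦ h) = ∑ p : Fin d × Fin d, h p.1 p.2 • unitHam n p := by
  simp only [unitHam]
  rw [← linearHam_const_sum]
  congr 1
  ext _ : 1
  conv_lhs => rw [Matrix.matrix_eq_sum_single h]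
  rw [Fintype.sum_prod_type]
  simp

/-- A matrix unit at one site is a partial isometry: it moves the coordinates with letter $b$ at
site $i$ injectively to those with letter $a$, and kills the rest. -/
theorem norm_siteOp_single_le (i : Fin n) (a b : Fin d) (ψ : Qudits n d) :
    ‖Matrix.toEuclideanLin (siteOp i (Matrix.single a b 1)) ψ‖ ≤ ‖ψ‖ := by
  have h1 : ∀ x y : Fin n → Fin d, siteOp i (Matrix.single a b 1) x y =
      if x i = a ∧ y = Function.update x i b then 1 else 0 := by
    intro x y
    rw [siteOp_apply]
    simp only [Matrix.one_apply, Matrix.single_apply]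
    rw [Finset.prod_ite_zero, ite_zero_mul_ite_zero]
    simp only [Finset.prod_const_one, mul_one]
    congr 1
    rw [eq_iff_iff]
    constructor
    · rintro ⟨⟨rfl, rfl⟩, h⟩
      refine ⟨rfl, ?_⟩
      ext k : 1
      by_cases hk : k = i
      · subst hk; simp
      · rw [Function.update_of_ne hk, h k (by simp [hk])]
    · rintro ⟨rfl, rfl⟩
      refine ⟨⟨rfl, by simp⟩, fun k hk ↦ ?_⟩
      rw [Function.update_of_ne (Finset.ne_of_mem_erase hk)]
  have h2 : ∀ x, Matrix.toEuclideanLin (siteOp i (Matrix.single a b 1)) ψ x =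
      if x i = a then ψ (Function.update x i b) else 0 := by
    intro x
    simp only [Matrix.toLpLin_apply, Matrix.mulVec, dotProduct, h1, ite_and]
    by_cases hx : x i = a <;> simp [hx]
  rw [EuclideanSpace.norm_eq, EuclideanSpace.norm_eq]
  apply Real.sqrt_le_sqrt
  simp only [h2]
  have h3 : ∀ x : Fin n → Fin d, ‖if x i = a then ψ (Function.update x i b) else 0‖ ^ 2 =
      if x i = a then ‖ψ (Function.update x i b)‖ ^ 2 else 0 := by
    intro x; split_ifs <;> simp
  simp only [h3]
  rw [← Finset.sum_filter]
  have hinj : Set.InjOn (fun x : Fin n → Fin d ↦ Function.update x i b)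
      (Finset.univ.filter fun x : Fin n → Fin d ↦ x i = a) := by
    intro x hx y hy hxy
    simp only [Finset.coe_filter, Finset.mem_univ, true_and, Set.mem_ofPred_eq] at hx hy
    ext k : 1
    by_cases hk : k = i
    · subst hk; rw [hx, hy]
    · have := congrFun hxy k
      simpa [Function.update_of_ne hk] using this
  rw [← Finset.sum_image (f := fun z ↦ ‖ψ z‖ ^ 2) hinj]
  exact Finset.sum_le_sum_of_subset_of_nonneg (Finset.subset_univ _) fun _ _ _ ↦ by positivity

theorem norm_unitHam_le (p : Fin d × Fin d) (ψ : Qudits n d) :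
    ‖Matrix.toEuclideanLin (unitHam n p) ψ‖ ≤ n * ‖ψ‖ := by
  rw [unitHam, linearHam, map_sum, LinearMap.sum_apply]
  refine (norm_sum_le_of_le _ fun i _ ↦ norm_siteOp_single_le i p.1 p.2 ψ).trans (le_of_eq ?_)
  simp

end Operators

/-! ### Fisher information in the occupation basis and its exact mean -/

section Energies

variable {n d : ℕ}

/-- The energy of the occupation vector `s` when the level `j` has energy `v j`. -/
def energy (v : Fin d → ℝ) (s : Sym (Fin d) n) : ℝ := ∑ j, v j * occ s j

theorem abs_energy_le {v : Fin d → ℝ} {B : ℝ} (hv : ∀ j, |v j| ≤ B) (s : Sym (Fin d) n) :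
    |energy v s| ≤ n * B := by
  calc |energy v s| ≤ ∑ j, |v j * occ s j| := Finset.abs_sum_le_sum_abs _ _
    _ ≤ ∑ j, B * occ s j := by
        refine Finset.sum_le_sum fun j _ ↦ ?_
        have h0 : 0 ≤ occ s j := Nat.cast_nonneg _
        rw [abs_mul, abs_of_nonneg h0]
        gcongr
        exact hv j
    _ = n * B := by rw [← Finset.mul_sum, sum_occ, mul_comm]

/-- The collective Hamiltonian with the one-particle Hamiltonian `levelHam φ v` at every site. -/
def collHam (n : ℕ) (φ : OrthonormalBasis (Fin d) ℂ (EuclideanSpace ℂ (Fin d))) (v : Fin d → ℝ) :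
    Op n d :=
  linearHam fun _ ↦ levelHam φ v

variable (φ : OrthonormalBasis (Fin d) ℂ (EuclideanSpace ℂ (Fin d))) (v : Fin d → ℝ)

/-- The probability of the occupation vector `s` in the state `ψ`. -/
def occProb (ψ : symSpace n d) (s : Sym (Fin d) n) : ℝ := ‖inner ℂ (occBasis φ s) ψ‖ ^ 2

theorem sum_occProb (ψ : symSpace n d) : ∑ s, occProb φ ψ s = ‖ψ‖ ^ 2 :=
  (occBasis φ).sum_sq_norm_inner_right ψ

theorem inner_of_occBasis_eigen {M : Op n d} {c : Sym (Fin d) n → ℝ}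
    (hM : ∀ s, Matrix.toEuclideanLin M (occVec φ s) = (c s : ℂ) • occVec φ s)
    (ψ : symSpace n d) :
    inner ℂ (ψ : Qudits n d) (Matrix.toEuclideanLin M ψ) =
      ((∑ s, c s * occProb φ ψ s : ℝ) : ℂ) := by
  have h1 : (ψ : Qudits n d) = ∑ s, inner ℂ (occBasis φ s) ψ • occVec φ s := by
    conv_lhs => rw [← (occBasis φ).sum_repr' ψ]
    simp [occBasis_apply]
  have h2 : Matrix.toEuclideanLin M ψ =
      ∑ s, (inner ℂ (occBasis φ s) ψ * c s) • occVec φ s := by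
    conv_lhs => rw [h1]
    simp only [map_sum, map_smul, hM, smul_smul]
  rw [h2, inner_sum, Complex.ofReal_sum]
  refine Finset.sum_congr rfl fun s _ ↦ ?_
  rw [inner_smul_right, ← occBasis_apply, ← Submodule.coe_inner, ← inner_conj_symm ψ, mul_right_comm,
    Complex.mul_conj', occProb]
  push_cast
  ring

theorem collHam_occVec (s : Sym (Fin d) n) :
    Matrix.toEuclideanLin (collHam n φ v) (occVec φ s) = (energy v s : ℂ) • occVec φ s :=
  linearHam_occVec φ v s

theorem collHam_mul_occVec (s : Sym (Fin d) n) :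
    Matrix.toEuclideanLin (collHam n φ v * collHam n φ v) (occVec φ s) =
      ((energy v s ^ 2 : ℝ) : ℂ) • occVec φ s := by
  rw [toEuclideanLin_mul_apply, collHam_occVec, map_smul, collHam_occVec, smul_smul]
  push_cast
  rw [sq]

theorem qfi_collHam (ψ : symSpace n d) :
    qfi (ψ : Qudits n d) (collHam n φ v) =
      4 * (∑ s, energy v s ^ 2 * occProb φ ψ s - (∑ s, energy v s * occProb φ ψ s) ^ 2) := by
  rw [qfi, inner_of_occBasis_eigen φ (collHam_occVec φ v),
    inner_of_occBasis_eigen φ (collHam_mul_occVec φ v), Complex.ofReal_re, Complex.ofReal_re]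

theorem integral_occProb_mul [NeZero d] (s t : Sym (Fin d) n) :
    ∫ ψ : SymState n d, occProb φ ψ s * occProb φ ψ t ∂uniformSym n d =
      (if s = t then 2 else 1) /
        (Fintype.card (Sym (Fin d) n) * (Fintype.card (Sym (Fin d) n) + 1)) := by
  have : Nontrivial (symSpace n d) :=
    ⟨occBasis φ (Sym.replicate n 0), 0, (occBasis φ).orthonormal.ne_zero _⟩
  exact integral_prob_mul_prob (Measure.addHaar : Measure (symSpace n d)) (occBasis φ) s t

theorem nontrivial_symSpace [NeZero d] : Nontrivial (symSpace n d) :=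
  ⟨occBasis (EuclideanSpace.basisFun (Fin d) ℂ) (Sym.replicate n 0), 0,
    (occBasis _).orthonormal.ne_zero _⟩

theorem isProbabilityMeasure_uniformSym [NeZero d] : IsProbabilityMeasure (uniformSym n d) :=
  have := nontrivial_symSpace (n := n) (d := d)
  isProbabilityMeasure_uniformSphere (Measure.addHaar : Measure (symSpace n d))

/-- The exact mean of the Fisher information of a collective Hamiltonian. -/
theorem integral_qfi_collHam [NeZero d] :
    ∫ ψ : SymState n d, qfi (ψ : symSpace n d) (collHam n φ v) ∂uniformSym n d =
      4 / (Fintype.card (Sym (Fin d) n) * (Fintype.card (Sym (Fin d) n) + 1)) *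
        (Fintype.card (Sym (Fin d) n) * ∑ s : Sym (Fin d) n, energy v s ^ 2 -
          (∑ s : Sym (Fin d) n, energy v s) ^ 2) := by
  have hexp : ∀ ψ : SymState n d, qfi (ψ : symSpace n d) (collHam n φ v) =
      ∑ s, ∑ t, 4 * (energy v s ^ 2 - energy v s * energy v t) *
        (occProb φ (ψ : symSpace n d) s * occProb φ (ψ : symSpace n d) t) := by
    intro ψ
    -- Multiplying the linear term by total probability $1$ makes the Fisher information a quadratic
    -- form in the probabilities, so only their second moments are needed.
    have h1 : ∑ s, occProb φ (ψ : symSpace n d) s = 1 := by rw [sum_occProb]; simp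
    have h2 : ∑ s, energy v s ^ 2 * occProb φ (ψ : symSpace n d) s =
        ∑ s, ∑ t, energy v s ^ 2 * occProb φ (ψ : symSpace n d) s *
          occProb φ (ψ : symSpace n d) t := by
      simp only [← Finset.mul_sum, h1, mul_one]
    rw [qfi_collHam, h2, sq, Finset.sum_mul_sum, ← Finset.sum_sub_distrib, Finset.mul_sum]
    refine Finset.sum_congr rfl fun s _ ↦ ?_
    rw [← Finset.sum_sub_distrib, Finset.mul_sum]
    exact Finset.sum_congr rfl fun t _ ↦ by ring
  have hint : ∀ s t, Integrable (fun ψ : SymState n d ↦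
      4 * (energy v s ^ 2 - energy v s * energy v t) *
        (occProb φ (ψ : symSpace n d) s * occProb φ (ψ : symSpace n d) t))
        (uniformSym n d) := by
    intro s t
    refine Integrable.const_mul (integrable_of_integral_pos ?_) _
    rw [integral_occProb_mul]
    have : Nonempty (Sym (Fin d) n) := ⟨s⟩
    have : (0 : ℝ) < Fintype.card (Sym (Fin d) n) := Nat.cast_pos.2 Fintype.card_pos
    split_ifs <;> positivity
  simp only [hexp]
  rw [integral_finsetSum _ fun s _ ↦ integrable_finsetSum _ fun t _ ↦ hint s t]
  simp only [integral_finsetSum _ fun t _ ↦ hint _ t, integral_const_mul, integral_occProb_mul]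
  set D : ℝ := (Fintype.card (Sym (Fin d) n) : ℝ) with hD
  -- The larger moment on the diagonal is harmless, because the coefficient $e_s^2-e_se_t$ vanishes
  -- when $s=t$.
  have h3 : ∀ s t : Sym (Fin d) n, 4 * (energy v s ^ 2 - energy v s * energy v t) *
      ((if s = t then 2 else 1) / (D * (D + 1))) =
      4 / (D * (D + 1)) * (energy v s ^ 2 - energy v s * energy v t) := by
    intro s t
    split_ifs with h
    · subst h; ring
    · ring
  simp only [h3, ← Finset.mul_sum, Finset.sum_sub_distrib]
  rw [sq (∑ s, energy v s), Finset.sum_mul_sum, Finset.mul_sum]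
  simp only [← Finset.mul_sum, Finset.sum_const, Finset.card_univ, nsmul_eq_mul, ← hD]

end Energies

/-! ### Compression to the symmetric subspace and deviations from the trace -/

section Compression

variable {n d : ℕ}

/-- The compression of an operator to the symmetric subspace. -/
def compress : Op n d →ₗ[ℂ] symSpace n d →ₗ[ℂ] symSpace n d where
  toFun M := ((symSpace n d).orthogonalProjectionOnto : Qudits n d →ₗ[ℂ] symSpace n d) ∘ₗ
    Matrix.toEuclideanLin M ∘ₗ (symSpace n d).subtype
  map_add' M N := by simp [LinearMap.add_comp, LinearMap.comp_add]
  map_smul' c M := by simp [LinearMap.smul_comp, LinearMap.comp_smul]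

theorem inner_compress (M : Op n d) (ψ χ : symSpace n d) :
    inner ℂ ψ (compress M χ) = inner ℂ (ψ : Qudits n d) (Matrix.toEuclideanLin M χ) := by
  simp [compress]

/-- The normalized trace of the compression to the symmetric subspace. -/
def symTrace : Op n d →ₗ[ℂ] ℂ :=
  ((Module.finrank ℂ (symSpace n d) : ℂ)⁻¹) • (LinearMap.trace ℂ (symSpace n d) ∘ₗ compress)

theorem symTrace_of_occBasis_eigen (φ : OrthonormalBasis (Fin d) ℂ (EuclideanSpace ℂ (Fin d)))
    {M : Op n d} {c : Sym (Fin d) n → ℝ}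
    (hM : ∀ s, Matrix.toEuclideanLin M (occVec φ s) = (c s : ℂ) • occVec φ s) :
    symTrace M = (((∑ s, c s) / Fintype.card (Sym (Fin d) n) : ℝ) : ℂ) := by
  have h : ∀ s, inner ℂ (occBasis φ s) (compress M (occBasis φ s)) = (c s : ℂ) := by
    intro s
    rw [inner_compress, occBasis_apply, hM, inner_smul_right,
      inner_self_eq_norm_sq_to_K, (orthonormal_occVec φ).1 s]
    simp
  simp only [symTrace, LinearMap.smul_apply, LinearMap.comp_apply]
  rw [LinearMap.trace_eq_sum_inner _ (occBasis φ), finrank_symSpace]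
  simp only [h, smul_eq_mul]
  push_cast
  rw [div_eq_inv_mul]

/-- The deviation of the expectation of `M` from its mean. -/
def deviation (M : Op n d) (ψ : symSpace n d) : ℂ :=
  inner ℂ (ψ : Qudits n d) (Matrix.toEuclideanLin M ψ) - symTrace M

/-- The deviation is linear in the operator. Control of finitely many fixed operators therefore
transfers to all their combinations at the same state. -/
theorem deviation_sum {ι : Type*} (s : Finset ι) (c : ι → ℂ) (M : ι → Op n d)
    (ψ : symSpace n d) :
    deviation (∑ a ∈ s, c a • M a) ψ = ∑ a ∈ s, c a * deviation (M a) ψ := by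
  simp only [deviation, map_sum, map_smul, LinearMap.sum_apply, LinearMap.smul_apply, inner_sum,
    inner_smul_right, smul_eq_mul, mul_sub, Finset.sum_sub_distrib]

theorem norm_inner_compress_le (M : Op n d) {R : ℝ}
    (hM : ∀ ψ, ‖Matrix.toEuclideanLin M ψ‖ ≤ R * ‖ψ‖) (x : symSpace n d) :
    ‖inner ℂ x (compress M x)‖ ≤ R * ‖x‖ ^ 2 := by
  rw [inner_compress]
  refine (norm_inner_le_norm _ _).trans ?_
  calc ‖(x : Qudits n d)‖ * ‖Matrix.toEuclideanLin M x‖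
      ≤ ‖(x : Qudits n d)‖ * (R * ‖(x : Qudits n d)‖) := by gcongr; exact hM _
    _ = R * ‖x‖ ^ 2 := by rw [Submodule.coe_norm]; ring

theorem deviation_eq (M : Op n d) (ψ : symSpace n d) :
    deviation M ψ = inner ℂ ψ (compress M ψ) -
      LinearMap.trace ℂ (symSpace n d) (compress M) / Module.finrank ℂ (symSpace n d) := by
  simp only [deviation, inner_compress, symTrace, LinearMap.smul_apply,
    LinearMap.comp_apply, smul_eq_mul, div_eq_inv_mul]

theorem uniformSym_deviation_tail [NeZero d] (M : Op n d) {R t : ℝ} (hR : 0 < R)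
    (hM : ∀ ψ, ‖Matrix.toEuclideanLin M ψ‖ ≤ R * ‖ψ‖) (ht : 0 < t) :
    (uniformSym n d).real {ψ | t < ‖deviation M (ψ : symSpace n d)‖} ≤
      4 * Real.exp (-((n + d - 1).choose n * t ^ 2 / (512 * R ^ 2))) := by
  have := nontrivial_symSpace (n := n) (d := d)
  have h := @uniformSphere_operator_tail (symSpace n d) _ _ _ _ _
    (Measure.addHaar : Measure (symSpace n d)) _ _ (compress M) R t hR
  replace h := h (norm_inner_compress_le M hM) ht
  simp only [deviation_eq]
  rw [finrank_symSpace_eq_choose] at h ⊢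
  exact h

end Compression

/-! ### Uniform bounds over the Hamiltonian class -/

section Class

variable {n d : ℕ}

/-- The levels of the averaged Hamiltonian are the column sums divided by $n$, so a gap $\kappa n$
between sums becomes a gap $\kappa$ between levels. -/
theorem exists_twirl_eq_collHam {A B κ : ℝ} (hA : 0 < A) (hn : n ≠ 0) {H : Op n d}
    (hH : H ∈ linearClass n d A B κ) :
    H.IsHermitian ∧ ∃ (φ : OrthonormalBasis (Fin d) ℂ (EuclideanSpace ℂ (Fin d)))
      (v : Fin d → ℝ), (∀ j, |v j| ≤ B) ∧ (∃ j j', j ≠ j' ∧ κ ≤ v j - v j') ∧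
        twirl H = collHam n φ v := by
  obtain ⟨φ, μ, hμ, ⟨j, j', hj, hκ⟩, rfl⟩ := hH
  have hn0 : (0 : ℝ) < n := by exact_mod_cast Nat.pos_of_ne_zero hn
  have hμB : ∀ i j, |μ i j| ≤ B := by
    intro i j
    rcases hμ i j with h | h
    · exact abs_le.2 ⟨h.1, by linarith [h.1, h.2]⟩
    · exact abs_le.2 ⟨by linarith [h.1, h.2], h.2⟩
  refine ⟨isHermitian_linearHam fun i ↦ isHermitian_levelHam φ (μ i), φ,
    fun j ↦ (∑ i, μ i j) / n, fun j ↦ ?_, ⟨j, j', hj, ?_⟩, ?_⟩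
  · rw [abs_div, Nat.abs_cast, div_le_iff₀ hn0]
    refine (Finset.abs_sum_le_sum_abs _ _).trans
      ((Finset.sum_le_sum fun i _ ↦ hμB i j).trans (le_of_eq ?_))
    simp [mul_comm]
  · rw [← sub_div, le_div_iff₀ hn0]
    exact hκ
  · rw [twirl_linearHam hn, sum_smul_levelHam, collHam]

theorem qfi_nonneg {H : Op n d} (hH : H.IsHermitian) {ψ : Qudits n d} (hψ : ‖ψ‖ = 1) :
    0 ≤ qfi ψ H := by
  rw [qfi_eq_of_isHermitian hH]
  have h1 : |(inner ℂ ψ (Matrix.toEuclideanLin H ψ)).re| ≤ ‖Matrix.toEuclideanLin H ψ‖ := by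
    refine (Complex.abs_re_le_norm _).trans ((norm_inner_le_norm _ _).trans ?_)
    rw [hψ, one_mul]
  have h2 := sq_le_sq' (neg_le_of_abs_le h1) (le_of_abs_le h1)
  linarith

variable [NeZero d]

theorem card_sym_pos : (0 : ℝ) < Fintype.card (Sym (Fin d) n) := by
  have : Nonempty (Sym (Fin d) n) := ⟨Sym.replicate n 0⟩
  exact Nat.cast_pos.2 Fintype.card_pos

/-- The variance of the energies over the occupation vectors. -/
def energyVar (n : ℕ) (v : Fin d → ℝ) : ℝ :=
  (∑ s : Sym (Fin d) n, energy v s ^ 2) / Fintype.card (Sym (Fin d) n) -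
    ((∑ s : Sym (Fin d) n, energy v s) / Fintype.card (Sym (Fin d) n)) ^ 2

theorem energyVar_nonneg (v : Fin d → ℝ) : 0 ≤ energyVar n v := by
  have hD := card_sym_pos (n := n) (d := d)
  have h := sq_sum_le_card_mul_sum_sq (s := Finset.univ) (f := fun s : Sym (Fin d) n ↦ energy v s)
  rw [Finset.card_univ] at h
  rw [energyVar, div_pow, sub_nonneg, div_le_div_iff₀ (by positivity) hD]
  nlinarith

theorem energyVar_le {v : Fin d → ℝ} {B : ℝ} (hv : ∀ j, |v j| ≤ B) :
    energyVar n v ≤ (n * B) ^ 2 := by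
  have hD := card_sym_pos (n := n) (d := d)
  have h : ∑ s : Sym (Fin d) n, energy v s ^ 2 ≤ Fintype.card (Sym (Fin d) n) * (n * B) ^ 2 := by
    calc ∑ s : Sym (Fin d) n, energy v s ^ 2 ≤ ∑ _s : Sym (Fin d) n, (n * B) ^ 2 := by
          refine Finset.sum_le_sum fun s _ ↦ ?_
          rw [← sq_abs]
          gcongr
          exact abs_energy_le hv s
      _ = _ := by simp
  have h2 : (∑ s : Sym (Fin d) n, energy v s ^ 2) / Fintype.card (Sym (Fin d) n) ≤ (n * B) ^ 2 := by
    rw [div_le_iff₀ hD]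
    linarith
  rw [energyVar]
  linarith [sq_nonneg ((∑ s : Sym (Fin d) n, energy v s) / (Fintype.card (Sym (Fin d) n) : ℝ))]

theorem le_energyVar (v : Fin d → ℝ) {j j' : Fin d} (hj : j ≠ j') :
    (v j - v j') ^ 2 * n ^ 2 / (2 * d * (d + 1)) ≤ energyVar n v := by
  have hD := card_sym_pos (n := n) (d := d)
  have h := le_variance_occ n v hj
  rw [Fintype.card_fin] at h
  change _ ≤ _ * ∑ s : Sym (Fin d) n, energy v s ^ 2 - (∑ s : Sym (Fin d) n, energy v s) ^ 2 at h
  refine le_of_mul_le_mul_left (h.trans (le_of_eq ?_)) (pow_pos hD 2)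
  rw [energyVar]
  field_simp

theorem meanQFI_eq (φ : OrthonormalBasis (Fin d) ℂ (EuclideanSpace ℂ (Fin d))) (v : Fin d → ℝ)
    {H : Op n d} (hH : twirl H = collHam n φ v) :
    meanQFI H = 4 * (Fintype.card (Sym (Fin d) n) / (Fintype.card (Sym (Fin d) n) + 1)) *
      energyVar n v := by
  have hD := card_sym_pos (n := n) (d := d)
  rw [meanQFI, hH, integral_qfi_collHam, energyVar]
  field_simp

theorem meanQFI_le (φ : OrthonormalBasis (Fin d) ℂ (EuclideanSpace ℂ (Fin d))) (v : Fin d → ℝ)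
    {H : Op n d} (hH : twirl H = collHam n φ v) : meanQFI H ≤ 4 * energyVar n v := by
  have hD := card_sym_pos (n := n) (d := d)
  have hV := energyVar_nonneg (n := n) v
  rw [meanQFI_eq φ v hH]
  have : (Fintype.card (Sym (Fin d) n) / (Fintype.card (Sym (Fin d) n) + 1) : ℝ) ≤ 1 := by
    rw [div_le_one (by positivity)]; linarith
  nlinarith

/-- The symmetric subspace has dimension $D\ge1$, hence $D/(D+1)\ge\frac12$. -/
theorem le_meanQFI (φ : OrthonormalBasis (Fin d) ℂ (EuclideanSpace ℂ (Fin d))) (v : Fin d → ℝ)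
    {H : Op n d} (hH : twirl H = collHam n φ v) : 2 * energyVar n v ≤ meanQFI H := by
  have hD : (1 : ℝ) ≤ Fintype.card (Sym (Fin d) n) := by
    exact_mod_cast card_sym_pos (n := n) (d := d)
  have hV := energyVar_nonneg (n := n) v
  rw [meanQFI_eq φ v hH]
  have : 1 / 2 ≤ (Fintype.card (Sym (Fin d) n) / (Fintype.card (Sym (Fin d) n) + 1) : ℝ) := by
    rw [div_le_div_iff₀ (by norm_num) (by positivity)]; linarith
  nlinarith

theorem meanQFI_bounds {A B κ : ℝ} (hA : 0 < A) (hκ : 0 < κ) (hn : n ≠ 0) {H : Op n d}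
    (hH : H ∈ linearClass n d A B κ) :
    κ ^ 2 / (d * (d + 1)) * n ^ 2 ≤ meanQFI H ∧ meanQFI H ≤ 4 * B ^ 2 * n ^ 2 := by
  obtain ⟨-, φ, v, hv, ⟨j, j', hj, hjj⟩, hT⟩ := exists_twirl_eq_collHam hA hn hH
  have hd : (0 : ℝ) < d := by exact_mod_cast Nat.pos_of_ne_zero (NeZero.ne d)
  constructor
  · refine le_trans ?_ (le_meanQFI φ v hT)
    have h1 := le_energyVar (n := n) v hj
    have h2 : κ ^ 2 ≤ (v j - v j') ^ 2 := by gcongr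
    calc κ ^ 2 / (d * (d + 1)) * n ^ 2 = 2 * (κ ^ 2 * n ^ 2 / (2 * d * (d + 1))) := by field_simp
      _ ≤ 2 * ((v j - v j') ^ 2 * n ^ 2 / (2 * d * (d + 1))) := by gcongr
      _ ≤ _ := by gcongr
  · refine (meanQFI_le φ v hT).trans ?_
    have := energyVar_le (n := n) hv
    nlinarith

/-- The Fisher information is controlled by the deviations of the collective matrix units and of
their products. -/
theorem le_qfi_collHam (φ : OrthonormalBasis (Fin d) ℂ (EuclideanSpace ℂ (Fin d)))
    {v : Fin d → ℝ} {B t₁ t₂ : ℝ} (hv : ∀ j, |v j| ≤ B) (hB : 0 ≤ B)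
    (ψ : SymState n d)
    (h₁ : ∀ p, ‖deviation (unitHam n p) (ψ : symSpace n d)‖ ≤ t₁)
    (h₂ : ∀ p q, ‖deviation (unitHam n p * unitHam n q) (ψ : symSpace n d)‖ ≤ t₂) :
    4 * energyVar n v - 4 * (d ^ 6 * B ^ 2 * t₂) - 8 * n * B * (d ^ 3 * B * t₁) ≤
      qfi (ψ : symSpace n d) (collHam n φ v) := by
  have hD := card_sym_pos (n := n) (d := d)
  have hsum : ∑ s, occProb φ (ψ : symSpace n d) s = 1 := by rw [sum_occProb]; simp
  have hnn : ∀ s, 0 ≤ occProb φ (ψ : symSpace n d) s := fun s ↦ by rw [occProb]; positivity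
  have hle := norm_levelHam_apply_le φ hv
  have hcoll : collHam n φ v = ∑ p : Fin d × Fin d, levelHam φ v p.1 p.2 • unitHam n p :=
    linearHam_const_eq_sum _
  have hcoll2 : collHam n φ v * collHam n φ v = ∑ r : (Fin d × Fin d) × (Fin d × Fin d),
      (levelHam φ v r.1.1 r.1.2 * levelHam φ v r.2.1 r.2.2) • (unitHam n r.1 * unitHam n r.2) := by
    rw [hcoll, Finset.sum_mul_sum]
    conv_rhs => rw [Fintype.sum_prod_type]
    simp only [smul_mul_smul_comm]
  set X := ∑ s, energy v s * occProb φ (ψ : symSpace n d) s with hX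
  set Y := ∑ s, energy v s ^ 2 * occProb φ (ψ : symSpace n d) s with hY
  set m := (∑ s : Sym (Fin d) n, energy v s) / (Fintype.card (Sym (Fin d) n) : ℝ) with hm
  set Z := (∑ s : Sym (Fin d) n, energy v s ^ 2) / (Fintype.card (Sym (Fin d) n) : ℝ) with hZ
  have hXm : |X - m| ≤ d ^ 3 * B * t₁ := by
    have h := deviation_sum Finset.univ (fun p : Fin d × Fin d ↦ levelHam φ v p.1 p.2)
      (unitHam n) (ψ : symSpace n d)
    rw [← hcoll, deviation, inner_of_occBasis_eigen φ (collHam_occVec φ v),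
      symTrace_of_occBasis_eigen φ (collHam_occVec φ v), ← Complex.ofReal_sub] at h
    calc |X - m| = ‖((X - m : ℝ) : ℂ)‖ := by rw [Complex.norm_real, Real.norm_eq_abs]
      _ ≤ ∑ _p : Fin d × Fin d, d * B * t₁ := by
          rw [h]
          refine norm_sum_le_of_le _ fun p _ ↦ ?_
          rw [norm_mul]
          exact mul_le_mul (hle _ _) (h₁ p) (norm_nonneg _) (by positivity)
      _ = d ^ 3 * B * t₁ := by simp; ring
  have hYZ : |Y - Z| ≤ d ^ 6 * B ^ 2 * t₂ := by
    have h := deviation_sum Finset.univ (fun r : (Fin d × Fin d) × (Fin d × Fin d) ↦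
      levelHam φ v r.1.1 r.1.2 * levelHam φ v r.2.1 r.2.2)
      (fun r ↦ unitHam n r.1 * unitHam n r.2) (ψ : symSpace n d)
    rw [← hcoll2, deviation, inner_of_occBasis_eigen φ (collHam_mul_occVec φ v),
      symTrace_of_occBasis_eigen φ (collHam_mul_occVec φ v), ← Complex.ofReal_sub] at h
    calc |Y - Z| = ‖((Y - Z : ℝ) : ℂ)‖ := by rw [Complex.norm_real, Real.norm_eq_abs]
      _ ≤ ∑ _r : (Fin d × Fin d) × (Fin d × Fin d), (d * B * (d * B)) * t₂ := by
          rw [h]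
          refine norm_sum_le_of_le _ fun r _ ↦ ?_
          rw [norm_mul, norm_mul]
          exact mul_le_mul (mul_le_mul (hle _ _) (hle _ _) (norm_nonneg _) (by positivity))
            (h₂ _ _) (norm_nonneg _) (by positivity)
      _ = d ^ 6 * B ^ 2 * t₂ := by simp; ring
  have hXB : |X| ≤ n * B := by
    calc |X| ≤ ∑ s, |energy v s * occProb φ (ψ : symSpace n d) s| := Finset.abs_sum_le_sum_abs _ _
      _ ≤ ∑ s, n * B * occProb φ (ψ : symSpace n d) s := by
          refine Finset.sum_le_sum fun s _ ↦ ?_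
          rw [abs_mul, abs_of_nonneg (hnn s)]
          exact mul_le_mul_of_nonneg_right (abs_energy_le hv s) (hnn s)
      _ = n * B := by rw [← Finset.mul_sum, hsum, mul_one]
  have hmB : |m| ≤ n * B := by
    rw [hm, abs_div, Nat.abs_cast, div_le_iff₀ hD]
    refine (Finset.abs_sum_le_sum_abs _ _).trans
      ((Finset.sum_le_sum fun s _ ↦ abs_energy_le hv s).trans (le_of_eq ?_))
    simp [mul_comm]
  -- The squared mean is of order $n^2$, so its error is the deviation times $|X+m|\le2nB$. This is
  -- why `t₁` must later be smaller than `t₂` by a factor of order $n$.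
  have hsq : |X ^ 2 - m ^ 2| ≤ d ^ 3 * B * t₁ * (2 * n * B) := by
    rw [sq_sub_sq, mul_comm, abs_mul]
    have : |X + m| ≤ 2 * n * B := by linarith [abs_add_le X m]
    exact mul_le_mul hXm this (abs_nonneg _) ((abs_nonneg _).trans hXm)
  rw [qfi_collHam, energyVar]
  have a1 := abs_le.1 hYZ
  have a2 := abs_le.1 hsq
  linarith [a1.1, a2.2]

/-- Uniform concentration of the Fisher information over the whole class. -/
theorem uniformSym_class_tail {A B κ c : ℝ} (hA : 0 < A) (hB : 0 < B) (hn : n ≠ 0) (hc : 0 < c) :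
    (uniformSym n d).real {ψ | ∃ H ∈ linearClass n d A B κ,
        qfi (ψ : symSpace n d) H - meanQFI H < -c} ≤
      8 * d ^ 4 * Real.exp (-((n + d - 1).choose n * c ^ 2 /
        (2 ^ 17 * d ^ 12 * B ^ 4 * n ^ 4))) := by
  have := isProbabilityMeasure_uniformSym (n := n) (d := d)
  have hd1 : (1 : ℝ) ≤ d := by exact_mod_cast Nat.pos_of_ne_zero (NeZero.ne d)
  have hd : (0 : ℝ) < d := by linarith
  have hn0 : (0 : ℝ) < n := by exact_mod_cast Nat.pos_of_ne_zero hn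
  set D : ℝ := ((n + d - 1).choose n : ℝ) with hD
  have hD0 : 0 ≤ D := Nat.cast_nonneg _
  -- The thresholds make each of the two error terms in `le_qfi_collHam` equal to $c/2$.
  set t₁ := c / (16 * n * B ^ 2 * d ^ 3) with ht₁
  set t₂ := c / (8 * d ^ 6 * B ^ 2) with ht₂
  have ht₁0 : 0 < t₁ := by positivity
  have ht₂0 : 0 < t₂ := by positivity
  set ex := Real.exp (-(D * c ^ 2 / (2 ^ 17 * d ^ 12 * B ^ 4 * n ^ 4))) with hex
  set S₁ : Fin d × Fin d → Set (SymState n d) :=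
    fun p ↦ {ψ | t₁ < ‖deviation (unitHam n p) (ψ : symSpace n d)‖} with hS₁
  set S₂ : (Fin d × Fin d) × (Fin d × Fin d) → Set (SymState n d) :=
    fun r ↦ {ψ | t₂ < ‖deviation (unitHam n r.1 * unitHam n r.2) (ψ : symSpace n d)‖} with hS₂
  have hb₁ : ∀ p, (uniformSym n d).real (S₁ p) ≤ 4 * ex := by
    intro p
    refine (uniformSym_deviation_tail (unitHam n p) hn0 (norm_unitHam_le p) ht₁0).trans ?_
    rw [hex]
    gcongr 4 * Real.exp (-?_)
    rw [ht₁, ← hD]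
    -- Here $2^{17}=512\cdot16^2$. The common exponent takes $2^{17}$ from this family and $d^{12}$
    -- from the products, the weaker choice in each case.
    have : D * (c / (16 * n * B ^ 2 * d ^ 3)) ^ 2 / (512 * n ^ 2) =
        D * c ^ 2 / (2 ^ 17 * d ^ 6 * B ^ 4 * n ^ 4) := by field_simp; ring
    rw [this]
    gcongr <;> norm_num
  have hb₂ : ∀ r, (uniformSym n d).real (S₂ r) ≤ 4 * ex := by
    intro r
    have hM : ∀ ψ, ‖Matrix.toEuclideanLin (unitHam n r.1 * unitHam n r.2) ψ‖ ≤
        (n : ℝ) ^ 2 * ‖ψ‖ := by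
      intro ψ
      rw [toEuclideanLin_mul_apply]
      refine (norm_unitHam_le _ _).trans ?_
      rw [sq, mul_assoc]
      gcongr
      exact norm_unitHam_le _ _
    refine (uniformSym_deviation_tail (unitHam n r.1 * unitHam n r.2) (pow_pos hn0 2) hM
      ht₂0).trans ?_
    rw [hex]
    gcongr 4 * Real.exp (-?_)
    rw [ht₂, ← hD]
    have : D * (c / (8 * d ^ 6 * B ^ 2)) ^ 2 / (512 * (n ^ 2) ^ 2) =
        D * c ^ 2 / (2 ^ 15 * d ^ 12 * B ^ 4 * n ^ 4) := by field_simp; ring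
    rw [this]
    gcongr <;> norm_num
  have hsub : {ψ : SymState n d | ∃ H ∈ linearClass n d A B κ,
      qfi (ψ : symSpace n d) H - meanQFI H < -c} ⊆ (⋃ p, S₁ p) ∪ ⋃ r, S₂ r := by
    rintro ψ ⟨H, hH, hlt⟩
    by_contra hcon
    simp only [Set.mem_union, Set.mem_iUnion, not_or, not_exists, hS₁, hS₂, Set.mem_ofPred_eq,
      not_lt] at hcon
    obtain ⟨hHerm, φ, v, hv, -, hT⟩ := exists_twirl_eq_collHam hA hn hH
    have h1 := le_qfi_collHam φ hv hB.le ψ hcon.1 fun p q ↦ hcon.2 (p, q)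
    have h2 := meanQFI_le φ v hT
    have h3 := qfi_twirl_le hHerm (ψ : symSpace n d).2
    rw [hT] at h3
    have e1 : 4 * (d ^ 6 * B ^ 2 * t₂) = c / 2 := by rw [ht₂]; field_simp; norm_num
    have e2 : 8 * n * B * (d ^ 3 * B * t₁) = c / 2 := by rw [ht₁]; field_simp; norm_num
    linarith
  have hex0 : 0 < ex := Real.exp_pos _
  calc (uniformSym n d).real _
      ≤ (uniformSym n d).real ((⋃ p, S₁ p) ∪ ⋃ r, S₂ r) := measureReal_mono hsub
    _ ≤ (uniformSym n d).real (⋃ p, S₁ p) + (uniformSym n d).real (⋃ r, S₂ r) :=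
        measureReal_union_le _ _
    _ ≤ ∑ p, (uniformSym n d).real (S₁ p) + ∑ r, (uniformSym n d).real (S₂ r) :=
        add_le_add (measureReal_iUnion_fintype_le _) (measureReal_iUnion_fintype_le _)
    _ ≤ ∑ _p : Fin d × Fin d, 4 * ex + ∑ _r : (Fin d × Fin d) × (Fin d × Fin d), 4 * ex :=
        add_le_add (Finset.sum_le_sum fun p _ ↦ hb₁ p) (Finset.sum_le_sum fun r _ ↦ hb₂ r)
    _ = 4 * (d ^ 2 + d ^ 4) * ex := by simp; ring
    _ ≤ 8 * d ^ 4 * ex := by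
        have : (d : ℝ) ^ 2 ≤ d ^ 4 := pow_le_pow_right₀ hd1 (by norm_num)
        nlinarith

end Class

/-! ### Comparison with the explicit bound and its limit -/

section Tail

theorem epsC_pos {d : ℕ} {B ε : ℝ} {n : ℕ} (hd : 0 < d) (hB : 0 < B) (hε : 0 < ε) (hn : 1 ≤ n) :
    0 < epsC d B ε n := by
  have hd' : (0 : ℝ) < d := by exact_mod_cast hd
  have hn' : (0 : ℝ) < n := by exact_mod_cast hn
  rw [epsC]
  positivity

theorem epsP_pos {d : ℕ} {C B ε : ℝ} {n : ℕ} (hd : 0 < d) (hC : 0 < C) (hB : 0 < B) (hε : 0 < ε)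
    (hn : 1 ≤ n) : 0 < epsP d C B ε n := by
  have hd' : (0 : ℝ) < d := by exact_mod_cast hd
  have hn' : (0 : ℝ) < n := by exact_mod_cast hn
  rw [epsP]
  positivity

theorem tailBound_nonneg {d : ℕ} {C K A B c ε : ℝ} {n : ℕ} (hd : 0 < d) (hC : 0 < C) (hA : 0 < A)
    (hAB : A < B) (hε : 0 < ε) (hn : 1 ≤ n) : 0 ≤ tailBound d C K A B c ε n := by
  have hB : 0 < B := hA.trans hAB
  have h1 := epsC_pos hd hB hε hn
  have h2 := epsP_pos hd hC hB hε hn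
  have h3 : 0 < B - A := sub_pos.2 hAB
  rw [tailBound]
  positivity

/-- The first factor supplies $4$, its base being at least $4$. The second supplies $d^4$: its base
is at least $d^2$ because $\epsilon<c\le4B^2n^2$, and its exponent is at least $2$. -/
theorem le_netCard {d : ℕ} {A B c ε : ℝ} {n : ℕ} (hd : 0 < d) (hA : 0 < A) (hAB : A < B)
    (hε : 0 < ε) (hεc : ε < c) (hn : 1 ≤ n) (hc : c ≤ 4 * B ^ 2 * n ^ 2) :
    4 * (d : ℝ) ^ 4 ≤ ((B - A) / epsC d B ε n + 4) ^ (d * n) *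
      (5 / epsP d 1 B ε n) ^ (d * (d + 1)) := by
  have hB : 0 < B := hA.trans hAB
  have hd' : (1 : ℝ) ≤ d := by exact_mod_cast hd
  have hn' : (1 : ℝ) ≤ n := by exact_mod_cast hn
  have h1 := epsC_pos hd hB hε hn
  have h3 : 0 < B - A := sub_pos.2 hAB
  have hp : (d : ℝ) ^ 2 ≤ 5 / epsP d 1 B ε n := by
    have hs : (1 : ℝ) ≤ 1 + 2 * √2 := by linarith [Real.sqrt_nonneg 2]
    have : 5 / epsP d 1 B ε n = 40 * (1 + 2 * √2) * d ^ 3 * n ^ 3 * B ^ 2 / ε := by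
      rw [epsP]; field_simp; ring
    rw [this, le_div_iff₀ hε]
    calc (d : ℝ) ^ 2 * ε ≤ d ^ 2 * (4 * B ^ 2 * n ^ 2) := by gcongr; linarith
      _ ≤ d ^ 3 * (4 * B ^ 2 * n ^ 3) := by gcongr <;> norm_num
      _ = 4 * 1 * d ^ 3 * n ^ 3 * B ^ 2 := by ring
      _ ≤ 40 * (1 + 2 * √2) * d ^ 3 * n ^ 3 * B ^ 2 := by gcongr; norm_num
  have hx : (4 : ℝ) ≤ ((B - A) / epsC d B ε n + 4) ^ (d * n) := by
    have h4 : (4 : ℝ) ≤ (B - A) / epsC d B ε n + 4 := by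
      have : 0 < (B - A) / epsC d B ε n := by positivity
      linarith
    exact h4.trans (le_self_pow₀ (by linarith) (Nat.mul_ne_zero hd.ne' (by omega)))
  have hy : (d : ℝ) ^ 4 ≤ (5 / epsP d 1 B ε n) ^ (d * (d + 1)) := by
    have h5 : (1 : ℝ) ≤ 5 / epsP d 1 B ε n := (one_le_pow₀ hd').trans hp
    calc (d : ℝ) ^ 4 = (d ^ 2) ^ 2 := by ring
      _ ≤ (5 / epsP d 1 B ε n) ^ 2 := by gcongr
      _ ≤ _ := pow_le_pow_right₀ h5 (by nlinarith)
  exact mul_le_mul hx hy (by positivity) (by positivity)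

/-- The value of `K`, the constant in the exponent of the tail bound. -/
def tailConst (d : ℕ) (B : ℝ) : ℝ := 1 + 2 ^ 17 * d ^ 12 * B ^ 4

theorem le_tailBound {d : ℕ} {A B c ε : ℝ} {n : ℕ} (hd : 0 < d) (hA : 0 < A) (hAB : A < B)
    (hε : 0 < ε) (hεc : ε < c) (hn : 1 ≤ n) (hc : c ≤ 4 * B ^ 2 * n ^ 2) :
    8 * d ^ 4 * Real.exp (-((n + d - 1).choose n * c ^ 2 / (2 ^ 17 * d ^ 12 * B ^ 4 * n ^ 4))) ≤
      tailBound d 1 (tailConst d B) A B c ε n := by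
  have hB : 0 < B := hA.trans hAB
  have hd' : (0 : ℝ) < d := by exact_mod_cast hd
  have hn' : (0 : ℝ) < n := by exact_mod_cast hn
  have hnet := le_netCard hd hA hAB hε hεc hn hc
  set D : ℝ := ((n + d - 1).choose n : ℝ)
  have hD : 0 ≤ D := Nat.cast_nonneg _
  -- The summand $1$ in `tailConst` ensures $K\ge1$, hence $K^4\ge K$, with no fourth root needed.
  have hK : 2 ^ 17 * d ^ 12 * B ^ 4 ≤ tailConst d B ^ 4 := by
    have h0 : 0 ≤ 2 ^ 17 * d ^ 12 * B ^ 4 := by positivity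
    have h1 : 1 ≤ tailConst d B := by rw [tailConst]; linarith
    refine le_trans ?_ (le_self_pow₀ h1 (by norm_num))
    rw [tailConst]; linarith
  have hconst : 2 ≤ 144 * Real.pi ^ 3 * Real.log 2 * (2 + 2 * √2) ^ 2 := by
    have h1 : (1 : ℝ) ≤ Real.pi ^ 3 := one_le_pow₀ (by linarith [Real.pi_gt_three])
    have h2 : (1 / 2 : ℝ) ≤ Real.log 2 := by linarith [Real.log_two_gt_d9]
    have h3 : (1 : ℝ) ≤ (2 + 2 * √2) ^ 2 := one_le_pow₀ (by linarith [Real.sqrt_nonneg 2])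
    calc (2 : ℝ) ≤ 144 * 1 * (1 / 2) * 1 := by norm_num
      _ ≤ _ := by gcongr
  have hexp : 2 * D * (c - ε) ^ 2 / (144 * Real.pi ^ 3 * Real.log 2 * (2 + 2 * √2) ^ 2 *
      (tailConst d B * n) ^ 4) ≤ D * c ^ 2 / (2 ^ 17 * d ^ 12 * B ^ 4 * n ^ 4) := by
    have hce : (c - ε) ^ 2 ≤ c ^ 2 := by
      have : 0 < c - ε := sub_pos.2 hεc
      gcongr
      linarith
    calc 2 * D * (c - ε) ^ 2 / (144 * Real.pi ^ 3 * Real.log 2 * (2 + 2 * √2) ^ 2 *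
          (tailConst d B * n) ^ 4)
        ≤ 2 * D * c ^ 2 / (2 * (2 ^ 17 * d ^ 12 * B ^ 4 * n ^ 4)) := by
          rw [mul_pow]
          gcongr
      _ = _ := by field_simp
  rw [tailBound]
  calc 8 * d ^ 4 * Real.exp (-(D * c ^ 2 / (2 ^ 17 * d ^ 12 * B ^ 4 * n ^ 4)))
      = 4 * d ^ 4 * (2 * Real.exp (-(D * c ^ 2 / (2 ^ 17 * d ^ 12 * B ^ 4 * n ^ 4)))) := by ring
    _ ≤ _ := by
        have : (0 : ℝ) ≤ 4 * d ^ 4 := by positivity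
        have := this.trans hnet
        gcongr

/-- By symmetry the binomial is $\binom{n+d-1}{d-1}$, a product of $d-1$ factors, each larger than
$n$, divided by $(d-1)!$. -/
theorem pow_le_factorial_mul_choose {d n : ℕ} (hd : 0 < d) :
    (n : ℝ) ^ (d - 1) ≤ (d - 1).factorial * (n + d - 1).choose n := by
  have h := Nat.pow_le_choose (α := ℝ) (d - 1) (n + d - 1)
  have e1 : n + d - 1 + 1 - (d - 1) = n + 1 := by omega
  have e2 : (n + d - 1).choose (d - 1) = (n + d - 1).choose n :=
    Nat.choose_symm_of_eq_add (by omega)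
  rw [e1, e2, div_le_iff₀ (by positivity)] at h
  refine le_trans ?_ (h.trans_eq (mul_comm _ _))
  gcongr
  linarith

open Filter Topology in
theorem tendsto_tailBound {d : ℕ} {C K A B c ε : ℝ} (hd : 13 < d) (hC : 0 < C) (hK : 0 < K)
    (hA : 0 < A) (hAB : A < B) (hε : 0 < ε) (hεc : ε < c) :
    Tendsto (tailBound d C K A B c ε) atTop (𝓝 0) := by
  have hB : 0 < B := hA.trans hAB
  have hd0 : 0 < d := by omega
  have hd' : (0 : ℝ) < d := by exact_mod_cast hd0
  have hBA : 0 < B - A := sub_pos.2 hAB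
  have hce : 0 < c - ε := sub_pos.2 hεc
  -- For $n\ge1$, the base of the first factor is at most $\alpha n^2$, that of the second is $\beta
  -- n^3$, and the exponent is at least $\gamma n^4$. Using $x\le e^x$, the whole prefactor is at
  -- most $e^{\delta n^3}$.
  set α : ℝ := (B - A) * (8 * (2 * d * B + d ^ 2 * (2 * B + 2) + 4 * B * (1 + d) / d)) / ε + 4
    with hα
  set β : ℝ := 40 * (1 + 2 * √2) * d ^ 3 * C * B ^ 2 / ε with hβ
  set q : ℝ := 144 * Real.pi ^ 3 * Real.log 2 * (2 + 2 * √2) ^ 2 with hq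
  have hq0 : 0 < q := by
    have := Real.log_pos one_lt_two
    positivity
  set γ : ℝ := 2 * (c - ε) ^ 2 / (q * K ^ 4 * (d - 1).factorial) with hγ
  have hγ0 : 0 < γ := by positivity
  have hα0 : 0 < α := by positivity
  have hβ0 : 0 < β := by positivity
  set δ : ℝ := α * d + β * (d * (d + 1)) with hδ
  have hδ0 : 0 < δ := by positivity
  have hbound : ∀ n : ℕ, 1 ≤ n → δ + 1 ≤ γ * n →
      tailBound d C K A B c ε n ≤ 2 * Real.exp (-(n : ℝ)) := by
    intro n hn hγn
    have hn' : (1 : ℝ) ≤ n := by exact_mod_cast hn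
    have hn0 : (0 : ℝ) < n := by linarith
    have hx : (B - A) / epsC d B ε n + 4 ≤ α * n ^ 2 := by
      have e1 : (B - A) / epsC d B ε n = (B - A) *
          (8 * (2 * (d * n) * B + (d * n) ^ 2 * (2 * B + 2) + 4 * B * n * (n + d) / d)) / ε := by
        rw [epsC]; field_simp
      have e2 : α * n ^ 2 = (B - A) * (8 * (2 * d * n ^ 2 * B + (d * n) ^ 2 * (2 * B + 2) +
          4 * B * n * (n + n * d) / d)) / ε + 4 * n ^ 2 := by
        rw [hα]; field_simp
      rw [e1, e2]
      have h2 : (n : ℝ) ≤ n ^ 2 := le_self_pow₀ hn' (by norm_num)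
      have h3 : 2 * (d * (n : ℝ)) * B ≤ 2 * d * n ^ 2 * B := by rw [← mul_assoc]; gcongr
      have h4 : (d : ℝ) ≤ n * d := le_mul_of_one_le_left hd'.le hn'
      have h5 : (4 : ℝ) ≤ 4 * n ^ 2 := by nlinarith
      gcongr
    have hy : 5 / epsP d C B ε n = β * n ^ 3 := by
      rw [epsP, hβ]; field_simp; ring
    have hx0 : 0 ≤ (B - A) / epsC d B ε n + 4 := by
      have := epsC_pos hd0 hB hε hn
      positivity
    have h1 : ((B - A) / epsC d B ε n + 4) ^ (d * n) ≤ Real.exp (α * d * n ^ 3) := by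
      calc ((B - A) / epsC d B ε n + 4) ^ (d * n) ≤ (Real.exp (α * n ^ 2)) ^ (d * n) := by
            gcongr
            linarith [Real.add_one_le_exp (α * (n : ℝ) ^ 2)]
        _ = Real.exp (α * d * n ^ 3) := by
            rw [← Real.exp_nat_mul]
            congr 1
            push_cast
            ring
    have h2 : (5 / epsP d C B ε n) ^ (d * (d + 1)) ≤ Real.exp (β * (d * (d + 1)) * n ^ 3) := by
      rw [hy]
      calc (β * (n : ℝ) ^ 3) ^ (d * (d + 1)) ≤ (Real.exp (β * n ^ 3)) ^ (d * (d + 1)) := by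
            gcongr
            linarith [Real.add_one_le_exp (β * (n : ℝ) ^ 3)]
        _ = _ := by
            rw [← Real.exp_nat_mul]
            congr 1
            push_cast
            ring
    have h3 : γ * n ^ 4 ≤ 2 * ((n + d - 1).choose n : ℝ) * (c - ε) ^ 2 / (q * (K * n) ^ 4) := by
      have hch := pow_le_factorial_mul_choose (n := n) hd0
      -- The largeness of $d$ enters here: after division by $(Kn)^4$, a power $n^8$ leaves $n^4$,
      -- which beats $\delta n^3$.
      have hpow : (n : ℝ) ^ 8 ≤ n ^ (d - 1) := pow_le_pow_right₀ hn' (by omega)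
      have hf : (0 : ℝ) < (d - 1).factorial := by exact_mod_cast Nat.factorial_pos _
      rw [le_div_iff₀ (by positivity)]
      calc γ * n ^ 4 * (q * (K * n) ^ 4)
          = 2 * (n ^ 8 / (d - 1).factorial) * (c - ε) ^ 2 := by rw [hγ]; field_simp
        _ ≤ 2 * ((n + d - 1).choose n : ℝ) * (c - ε) ^ 2 := by
            gcongr
            rw [div_le_iff₀ hf]
            linarith
    rw [tailBound]
    calc ((B - A) / epsC d B ε n + 4) ^ (d * n) * (5 / epsP d C B ε n) ^ (d * (d + 1)) *
          (2 * Real.exp (-(2 * ((n + d - 1).choose n : ℝ) * (c - ε) ^ 2 / (q * (K * n) ^ 4))))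
        ≤ Real.exp (α * d * n ^ 3) * Real.exp (β * (d * (d + 1)) * n ^ 3) *
          (2 * Real.exp (-(γ * n ^ 4))) := by
          have : 0 ≤ 5 / epsP d C B ε n := by rw [hy]; positivity
          gcongr
      _ = 2 * Real.exp (α * d * n ^ 3 + β * (d * (d + 1)) * n ^ 3 + -(γ * n ^ 4)) := by
          rw [Real.exp_add, Real.exp_add]; ring
      _ ≤ 2 * Real.exp (-(n : ℝ)) := by
          gcongr
          have e : α * d * n ^ 3 + β * (d * (d + 1)) * n ^ 3 + -(γ * n ^ 4) =
              n ^ 3 * (δ - γ * n) := by rw [hδ]; ring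
          rw [e]
          have h4 : (n : ℝ) ≤ n ^ 3 := le_self_pow₀ hn' (by norm_num)
          nlinarith [pow_pos hn0 3]
  have hlim : Tendsto (fun n : ℕ ↦ 2 * Real.exp (-(n : ℝ))) atTop (𝓝 0) := by
    have := (Real.tendsto_exp_neg_atTop_nhds_zero.comp tendsto_natCast_atTop_atTop).const_mul 2
    simpa using this
  refine squeeze_zero' ?_ ?_ hlim
  · filter_upwards [eventually_ge_atTop 1] with n hn
    exact tailBound_nonneg hd0 hC hA hAB hε hn
  · have h1 : ∀ᶠ n : ℕ in atTop, δ + 1 ≤ γ * n :=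
      (tendsto_natCast_atTop_atTop.const_mul_atTop hγ0).eventually_ge_atTop _
    filter_upwards [eventually_ge_atTop 1, h1] with n hn hγn
    exact hbound n hn hγn

theorem uniformSym_class_le_tailBound {d : ℕ} (hd : 0 < d) {A B κ c ε : ℝ} {n : ℕ} (hA : 0 < A)
    (hAB : A < B) (hκ : 0 < κ) (hε : 0 < ε) (hεc : ε < c) (hn : 1 ≤ n) :
    (uniformSym n d).real {ψ | ∃ H ∈ linearClass n d A B κ,
        qfi (ψ : symSpace n d) H - meanQFI H < -c} ≤
      tailBound d 1 (tailConst d B) A B c ε n := by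
  have : NeZero d := ⟨hd.ne'⟩
  have hn0 : n ≠ 0 := by omega
  have hB : 0 < B := hA.trans hAB
  -- For larger $c$ the event is empty, since the Fisher information is nonnegative and its
  -- benchmark is at most $4B^2n^2$.
  by_cases hc : c ≤ 4 * B ^ 2 * n ^ 2
  · exact (uniformSym_class_tail hA hB hn0 (hε.trans hεc)).trans
      (le_tailBound hd hA hAB hε hεc hn hc)
  · have hempty : {ψ : SymState n d | ∃ H ∈ linearClass n d A B κ,
        qfi (ψ : symSpace n d) H - meanQFI H < -c} = ∅ := by
      refine Set.eq_empty_of_forall_notMem ?_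
      rintro ψ ⟨H, hH, hlt⟩
      have h1 := (meanQFI_bounds hA hκ hn0 hH).2
      have h2 := qfi_nonneg (exists_twirl_eq_collHam hA hn0 hH).1
        (ψ := ((ψ : symSpace n d) : Qudits n d)) (norm_eq_of_mem_sphere ψ)
      linarith
    rw [hempty, measureReal_empty]
    exact tailBound_nonneg hd one_pos hA hAB hε hn

end Tail

end SymQFI

end

/-! ### The main theorem -/

open SymQFI Filter Topology in
theorem mainTheorem1 (d : ℕ) (hd : 13 < d) :
    ∃ C : ℝ, 0 < C ∧ ∀ A B : ℝ, 0 < A → A < B → ∃ K : ℝ, 0 < K ∧ ∀ κ : ℝ, 0 < κ →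
      -- the benchmark `E[F_Q(ψ, H_S)]` and the probability that some `H` falls below it by `c`
      (∀ c ε : ℝ, 0 < ε → ε < c →
        (∀ n : ℕ, 1 ≤ n →
          (uniformSym n d).real {ψ | ∃ H ∈ linearClass n d A B κ,
            qfi (ψ : symSpace n d) H - meanQFI H < -c} ≤ tailBound d C K A B c ε n) ∧
        Tendsto (tailBound d C K A B c ε) atTop (𝓝 0)) ∧
      (∀ c : ℝ, 0 < c →
        Tendsto (fun n : ℕ => (uniformSym n d).real {ψ | ∃ H ∈ linearClass n d A B κ,
          meanQFI H - qfi (ψ : symSpace n d) H > c}) atTop (𝓝 0)) ∧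
      -- the benchmark is of order `n ^ 2`, uniformly over the class
      ∃ a b : ℝ, 0 < a ∧ 0 < b ∧
        (∀ n : ℕ, 1 ≤ n → ∀ H ∈ linearClass n d A B κ,
          a * (n : ℝ) ^ 2 ≤ meanQFI H ∧ meanQFI H ≤ b * (n : ℝ) ^ 2) ∧
        ∀ c : ℝ, 0 < c →
          Tendsto (fun n : ℕ => (uniformSym n d).real {ψ | ∃ H ∈ linearClass n d A B κ,
            a * (n : ℝ) ^ 2 - qfi (ψ : symSpace n d) H > c}) atTop (𝓝 0) := by
  have hd0 : 0 < d := by omega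
  have hd' : (0 : ℝ) < d := by exact_mod_cast hd0
  have : NeZero d := ⟨hd0.ne'⟩
  refine ⟨1, one_pos, fun A B hA hAB ↦ ?_⟩
  have hB : 0 < B := hA.trans hAB
  have hK : 0 < tailConst d B := by rw [tailConst]; positivity
  refine ⟨tailConst d B, hK, fun κ hκ ↦ ?_⟩
  -- Both limit statements concern events contained in the one already bounded, so the explicit
  -- bound with $\epsilon=c/2$ squeezes them to $0$. For the benchmark $an^2$ the inclusion uses
  -- $an^2\le E(H)$.
  have htail : ∀ c : ℝ, 0 < c → ∀ P : (n : ℕ) → Set (SymState n d),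
      (∀ n, 1 ≤ n → P n ⊆ {ψ | ∃ H ∈ linearClass n d A B κ,
        qfi (ψ : symSpace n d) H - meanQFI H < -c}) →
      Tendsto (fun n : ℕ => (uniformSym n d).real (P n)) atTop (𝓝 0) := by
    intro c hc P hP
    refine squeeze_zero' (Eventually.of_forall fun n ↦ measureReal_nonneg) ?_
      (tendsto_tailBound hd one_pos hK hA hAB (half_pos hc) (half_lt_self hc))
    filter_upwards [eventually_ge_atTop 1] with n hn
    have := isProbabilityMeasure_uniformSym (n := n) (d := d)
    exact (measureReal_mono (hP n hn)).trans
      (uniformSym_class_le_tailBound hd0 hA hAB hκ (half_pos hc) (half_lt_self hc) hn)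
  refine ⟨fun c ε hε hεc ↦ ⟨fun n hn ↦ uniformSym_class_le_tailBound hd0 hA hAB hκ hε hεc hn,
    tendsto_tailBound hd one_pos hK hA hAB hε hεc⟩, fun c hc ↦ htail c hc _ fun n _ ↦ ?_,
    κ ^ 2 / (d * (d + 1)), 4 * B ^ 2, by positivity, by positivity,
    fun n hn H hH ↦ meanQFI_bounds hA hκ (by omega) hH, fun c hc ↦ htail c hc _ fun n hn ↦ ?_⟩
  · rintro ψ ⟨H, hH, hlt⟩
    exact ⟨H, hH, by linarith⟩
  · rintro ψ ⟨H, hH, hlt⟩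
    exact ⟨H, hH, by linarith [(meanQFI_bounds hA hκ (by omega) hH).1]⟩
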